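/- **Corollary 5 (LSI for ZRP on arbitrary geometries).** Let $m,n\ge 1$ be integers, let $G=(G_{ij})_{1\le i,j\le n}$ be a symmetric stochastic matrix, and let $r_i\colon\{0,1,2,\ldots\}\to[0,\infty)$, $1\le i\le n$, be functions with $r_i(0)=0$ whose increments satisfy $$\delta\ \le\ r_i(k+1)-r_i(k)\ \le\ \Delta\qquad (1\le i\le n,\ k\ge 0)$$ for some constants $\delta,\Delta>0$. The Zero-Range Process with these parameters is the continuous-time Markov chain on $\mathcal X=\{x\in\mathbb Z_+^n\colon x_1+\cdots+x_n=m\}$ with generator $$(Qf)(x)=\sum_{1\le i,j\le n} r_i(x_i)\,G_{ij}\,\bigl(f(x+\delta_j-\delta_i)-f(x)\bigr),$$ where $(\delta_1,\ldots,\delta_n)$ is the canonical basis. Let $\pi$ be a probability measure on $\mathcal X$ with respect to which $Q$ is reversible (it exists, and is unique when $G$ is irreducible), write $\mathbf E$ for expectation under $\pi$, $\mathrm{Ent}(f)=\mathbf E[f\log f]-\mathbf E[f]\log\mathbf E[f]$ and $\mathcal E(f,g)=\frac12\sum_{x,y\in\mathcal X}\pi(x)Q(x,y)(f(x)-f(y))(g(x)-g(y))$,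 and let $\mathrm t_{\rm ls}\in[0,\infty]$ be the log-Sobolev constant, i.e. the optimal $t\ge 0$ such that $\mathrm{Ent}(f)\le t\,\mathcal E(\sqrt f,\sqrt f)$ for all $f\colon\mathcal X\to(0,\infty)$. Then $$\mathrm t_{\rm ls}\ \le\ \frac{40\,\Delta}{\gamma(G)\,\delta^2}\,\log\left(\frac{\Delta m n}{\delta}\right),$$ where $\gamma(G)=1-\lambda_2(G)$ is the spectral gap of $G$, with $\lambda_2(G)$ the second largest eigenvalue of $G$ counted with multiplicity (and $\gamma(G):=1$ if $n=1$). When $\gamma(G)=0$, i.e. when $G$ is not irreducible, the right-hand side is read as $+\infty$. -/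

import Mathlib

/-! ### Reversible Markov generators on a finite state space -/

namespace MarkovGen

variable {X : Type*} [Fintype X]

/-- `π` is a probability vector on `X`, and the generator with matrix `Q` is reversible with
respect to it (detailed balance). -/
structure IsReversible (Q : Matrix X X ℝ) (π : X → ℝ) : Prop where
  nonneg : ∀ x, 0 ≤ π x
  sum_eq_one : ∑ x, π x = 1
  balance : ∀ x y, π x * Q x y = π y * Q y x

/-- The Dirichlet form `(1/2) ∑ π(x) Q(x,y) (f(x) - f(y)) (g(x) - g(y))`. -/
noncomputable def dirichlet (Q : Matrix X X ℝ) (π : X → ℝ) (f g : X → ℝ) : ℝ :=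
  (1 / 2) * ∑ x, ∑ y, π x * Q x y * (f x - f y) * (g x - g y)

/-- Expectation with respect to `π`. -/
def expect (π : X → ℝ) (f : X → ℝ) : ℝ := ∑ x, π x * f x

/-- Entropy `E[f log f] - E[f] log E[f]`, for `f > 0`. -/
noncomputable def ent (π : X → ℝ) (f : X → ℝ) : ℝ :=
  expect π (fun x => f x * Real.log (f x)) - expect π f * Real.log (expect π f)

/-- The log-Sobolev inequality with constant `t`. -/
def LSI (Q : Matrix X X ℝ) (π : X → ℝ) (t : ℝ) : Prop :=
  ∀ f : X → ℝ, (∀ x, 0 < f x) →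
    ent π f ≤ t * dirichlet Q π (fun x => Real.sqrt (f x)) (fun x => Real.sqrt (f x))

/-- The log-Sobolev constant: the optimal constant `t ≥ 0` in the log-Sobolev inequality
(`∞` if the inequality holds with no finite constant). -/
noncomputable def tLS (Q : Matrix X X ℝ) (π : X → ℝ) : ENNReal :=
  sInf {c : ENNReal | ∃ t : ℝ, 0 ≤ t ∧ LSI Q π t ∧ c = ENNReal.ofReal t}

end MarkovGen

/-! ### The geometry -/

/-- The spectral gap `1 - λ₂` of a real symmetric stochastic `n × n` matrix, where
`λ₁ ≥ λ₂ ≥ … ≥ λₙ` are its eigenvalues listed with multiplicity (`eigenvalues₀` is this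
decreasing list, indexed from `0`). A `1 × 1` stochastic matrix has no second eigenvalue; its gap
is taken to be `1`. -/
noncomputable def spectralGap {n : ℕ} (G : Matrix (Fin n) (Fin n) ℝ) (hG : G.IsSymm) : ℝ :=
  if h : 2 ≤ n then
    1 - Matrix.IsHermitian.eigenvalues₀ (A := G)
      ((Matrix.conjTranspose_eq_transpose_of_trivial G).trans hG)
      ⟨1, by rw [Fintype.card_fin]; exact h⟩
  else 1

/-! ### The zero-range process -/

namespace ZRP

/-- Configurations of `m` particles on `n` sites. -/
abbrev State (n m : ℕ) : Type := {x : Fin n → ℕ // ∑ i, x i = m}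

instance instFintypeState (n m : ℕ) : Fintype (State n m) :=
  Fintype.subtype (Finset.piAntidiag Finset.univ m) (by simp)

theorem sum_move {n : ℕ} (x : Fin n → ℕ) (i j : Fin n) (h : x i ≠ 0) :
    ∑ k, (x + (Pi.single j 1 : Fin n → ℕ) - (Pi.single i 1 : Fin n → ℕ)) k = ∑ k, x k := by
  have hle : ∀ k ∈ (Finset.univ : Finset (Fin n)),
      (Pi.single i 1 : Fin n → ℕ) k ≤ x k + (Pi.single j 1 : Fin n → ℕ) k := by
    intro k _
    by_cases hk : k = i
    · subst hk
      rw [Pi.single_eq_same]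
      omega
    · simp [hk]
  simp only [Pi.sub_apply, Pi.add_apply]
  rw [Finset.sum_tsub_distrib _ hle]
  simp [Finset.sum_add_distrib]

/-- The configuration `x + δ_j - δ_i` obtained when a particle moves from `i` to `j`. If `i` is
empty no such move exists and `x` is returned; the corresponding rate `r_i(0)` is zero. -/
def move {n m : ℕ} (x : State n m) (i j : Fin n) : State n m :=
  if h : x.1 i = 0 then x
  else ⟨x.1 + Pi.single j 1 - Pi.single i 1, (sum_move x.1 i j h).trans x.2⟩

/-- The generator `(Q f)(x) = ∑_{i,j} r_i(x_i) G_{ij} (f(x + δ_j - δ_i) - f(x))`. -/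
def gen {n : ℕ} (m : ℕ) (r : Fin n → ℕ → ℝ) (G : Matrix (Fin n) (Fin n) ℝ)
    (f : State n m → ℝ) (x : State n m) : ℝ :=
  ∑ i, ∑ j, r i (x.1 i) * G i j * (f (move x i j) - f x)

/-- The matrix of the generator: `Q(x,y) = (Q 1_y)(x)`. -/
def rateMatrix {n : ℕ} (m : ℕ) (r : Fin n → ℕ → ℝ) (G : Matrix (Fin n) (Fin n) ℝ) :
    Matrix (State n m) (State n m) ℝ :=
  fun x y => gen m r G (Pi.single y 1) x

end ZRP

/-!
The proof reduces the geometry `G` to the complete graph, the complete graph to a single site, and a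
single site to an elementary inequality for three-point measures.

* Reduction to the complete graph. Conditionally on all particles but one, detailed balance and the
  Poincaré inequality `spectralGap_mul_le` for `G` bound the energy on the complete graph by the
  energy on `G`, at the price of the factor `1 / γ(G)`. The same inequality, applied to the density
  of `π`, shows that `π` is the normalised product weight (`MeanField.RateBounds.reversible_eq`).

* Reduction to a single site. On the complete graph one proceeds by induction on the number of sites
  (`MeanField.RateBounds.wEnt_le_edgeEnergy`). By the chain rule the entropy splits into the entropy
  given the number of particles at a site `i`, which the induction hypothesis controls, and the
  entropy of the conditional mean of `f` as a function of that number; this is averaged over `i`.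
  The increments of the conditional mean are controlled by a coupling of the systems with `l` and
  `l + 1` particles on the other sites, which differ by one particle
  (`MeanField.RateBounds.exists_coupling`). It is the stationary law of a second-class particle,
  which leaves its site at a rate in `[δ, Δ]` and jumps to a uniform site, so that a maximum
  principle bounds its conditional law by `Δ / δ` times the uniform one.

* A single site. The number of particles at a site performs a birth–death chain whose death rates
  increase by at least `δ` and whose birth rates do not increase. Two neighbouring copies meet at
  rate at least `δ`, so the energy `∑ (√f(k) - √f(k+1))²`, which is jointly convex in its arguments,
  contracts along the discrete-time chain with a small step `ε`. The entropy lost in one step is an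
  average of entropies of three-point measures whose atoms have mass at least
  `p = δ / (2 Δ m n)`, and for these the entropy is at most `5 log (1 / p)` times the variance of
  `√f` (`MeanField.wEnt_le_log_mul_variance`). Summing over the steps gives the logarithmic Sobolev
  inequality with constant of order `log (1 / p) / δ` (`MeanField.BirthDeath.wEnt_le`).
-/

/-! ### Entropy and the Hellinger distance -/

namespace MeanField

/-- The entropy `∑ w F log F - (∑ w F) log (∑ w F / ∑ w)` of `F` with respect to a finite measure
`w` on `s` that need not have mass one; it is homogeneous of degree one in `w`. -/
noncomputable def wEnt {α : Type*} (s : Finset α) (w F : α → ℝ) : ℝ :=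
  ∑ x ∈ s, w x * (F x * Real.log (F x))
    - (∑ x ∈ s, w x * F x) * Real.log ((∑ x ∈ s, w x * F x) / ∑ x ∈ s, w x)

/-- The squared Hellinger distance `(√a - √b)²` between two numbers. -/
noncomputable def sqDist (a b : ℝ) : ℝ := (Real.sqrt a - Real.sqrt b) ^ 2

theorem sqDist_nonneg (a b : ℝ) : 0 ≤ sqDist a b := sq_nonneg _

theorem sqDist_self (a : ℝ) : sqDist a a = 0 := by simp [sqDist]

theorem sqDist_comm (a b : ℝ) : sqDist a b = sqDist b a := by
  unfold sqDist; ring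

theorem sqDist_eq {a b : ℝ} (ha : 0 ≤ a) (hb : 0 ≤ b) :
    sqDist a b = a + b - 2 * (Real.sqrt a * Real.sqrt b) := by
  have h1 := Real.sq_sqrt ha
  have h2 := Real.sq_sqrt hb
  unfold sqDist
  linear_combination h1 + h2

/-- `sqDist` is jointly sublinear, by the Cauchy–Schwarz inequality. -/
theorem sqDist_sum_le {α : Type*} (s : Finset α) (p a b : α → ℝ) (hp : ∀ x ∈ s, 0 ≤ p x)
    (ha : ∀ x ∈ s, 0 ≤ a x) (hb : ∀ x ∈ s, 0 ≤ b x) :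
    sqDist (∑ x ∈ s, p x * a x) (∑ x ∈ s, p x * b x) ≤ ∑ x ∈ s, p x * sqDist (a x) (b x) := by
  have hA : ∀ x ∈ s, 0 ≤ p x * a x := fun x hx => mul_nonneg (hp x hx) (ha x hx)
  have hB : ∀ x ∈ s, 0 ≤ p x * b x := fun x hx => mul_nonneg (hp x hx) (hb x hx)
  rw [sqDist_eq (Finset.sum_nonneg hA) (Finset.sum_nonneg hB)]
  have hcs : ∑ x ∈ s, p x * (Real.sqrt (a x) * Real.sqrt (b x))
      ≤ Real.sqrt (∑ x ∈ s, p x * a x) * Real.sqrt (∑ x ∈ s, p x * b x) := by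
    have h0 : ∑ x ∈ s, p x * (Real.sqrt (a x) * Real.sqrt (b x))
        = ∑ x ∈ s, (Real.sqrt (p x) * Real.sqrt (a x)) * (Real.sqrt (p x) * Real.sqrt (b x)) := by
      refine Finset.sum_congr rfl fun x hx => ?_
      have := Real.mul_self_sqrt (hp x hx)
      linear_combination -(Real.sqrt (a x) * Real.sqrt (b x)) * this
    rw [h0, ← Real.sqrt_mul (Finset.sum_nonneg hA)]
    refine Real.le_sqrt_of_sq_le ((Finset.sum_mul_sq_le_sq_mul_sq s _ _).trans (le_of_eq ?_))
    congr 1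
    · refine Finset.sum_congr rfl fun x hx => ?_
      rw [mul_pow, Real.sq_sqrt (hp x hx), Real.sq_sqrt (ha x hx)]
    · refine Finset.sum_congr rfl fun x hx => ?_
      rw [mul_pow, Real.sq_sqrt (hp x hx), Real.sq_sqrt (hb x hx)]
  have h1 : ∑ x ∈ s, p x * sqDist (a x) (b x)
      = ∑ x ∈ s, p x * a x + ∑ x ∈ s, p x * b x
        - 2 * ∑ x ∈ s, p x * (Real.sqrt (a x) * Real.sqrt (b x)) := by
    rw [Finset.mul_sum, ← Finset.sum_add_distrib, ← Finset.sum_sub_distrib]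
    refine Finset.sum_congr rfl fun x hx => ?_
    rw [sqDist_eq (ha x hx) (hb x hx)]; ring
  rw [h1]; linarith

/-- The variational formula for the entropy: the right-hand side is smallest when `c` is the mean
of `F`. -/
theorem wEnt_le {α : Type*} (s : Finset α) (w F : α → ℝ) (hw : ∀ x ∈ s, 0 ≤ w x)
    (hW : 0 < ∑ x ∈ s, w x) (hF : ∀ x ∈ s, 0 < F x) {c : ℝ} (hc : 0 < c) :
    wEnt s w F ≤ ∑ x ∈ s, w x * (F x * Real.log (F x / c) - F x + c) := by
  set A := ∑ x ∈ s, w x * F x with hA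
  set W := ∑ x ∈ s, w x with hWdef
  have hApos : 0 < A := by
    obtain ⟨x, hx, hwx⟩ := (Finset.sum_pos_iff_of_nonneg hw).1 hW
    exact Finset.sum_pos' (fun x hx => mul_nonneg (hw x hx) (hF x hx).le)
      ⟨x, hx, mul_pos hwx (hF x hx)⟩
  have h1 : ∑ x ∈ s, w x * (F x * Real.log (F x / c) - F x + c)
      = ∑ x ∈ s, w x * (F x * Real.log (F x)) - A * Real.log c - A + c * W := by
    rw [hA, hWdef, Finset.mul_sum, Finset.sum_mul, ← Finset.sum_sub_distrib,
      ← Finset.sum_sub_distrib, ← Finset.sum_add_distrib]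
    refine Finset.sum_congr rfl fun x hx => ?_
    rw [Real.log_div (hF x hx).ne' hc.ne']; ring
  have h2 : A - c * W ≤ A * Real.log (A / W) - A * Real.log c := by
    have h3 := Real.one_sub_inv_le_log_of_pos (div_pos (div_pos hApos hW) hc)
    rw [Real.log_div (div_pos hApos hW).ne' hc.ne'] at h3
    have h4 := mul_le_mul_of_nonneg_left h3 hApos.le
    have h5 : A * (1 - (A / W / c)⁻¹) = A - c * W := by
      field_simp
    linarith
  unfold wEnt
  rw [h1]
  linarith

/-- The elementary inequality behind the logarithmic Sobolev inequality for a measure whose atoms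
have mass at least `1 / N`. -/
theorem two_mul_sq_mul_log_le {t N : ℝ} (hN : 4 ≤ N) (ht : 0 < t) (htN : t ≤ N) :
    2 * t ^ 2 * Real.log t - t ^ 2 + 1 ≤ 5 * Real.log N * (t - 1) ^ 2 := by
  have hlog4 : (1.386 : ℝ) ≤ Real.log N := by
    have h1 : Real.log 4 ≤ Real.log N := Real.log_le_log (by norm_num) hN
    have h2 : Real.log 4 = 2 * Real.log 2 := by
      rw [show (4 : ℝ) = 2 ^ 2 by norm_num, Real.log_pow]; norm_num
    have := Real.log_two_gt_d9
    linarith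
  rcases le_total t 2.9 with h | h
  · -- near `1` the bound `log t ≤ t - 1` suffices
    have h1 : Real.log t ≤ t - 1 := Real.log_le_sub_one_of_pos ht
    have h2 : 2 * t ^ 2 * Real.log t - t ^ 2 + 1 ≤ (2 * t + 1) * (t - 1) ^ 2 := by
      nlinarith [mul_le_mul_of_nonneg_left h1 (by positivity : 0 ≤ 2 * t ^ 2)]
    refine h2.trans (mul_le_mul_of_nonneg_right ?_ (sq_nonneg _))
    linarith
  · -- away from `1` the ratio `t² / (t - 1)²` is at most `5 / 2`
    have h1 : Real.log t ≤ Real.log N := Real.log_le_log ht htN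
    have h2 : 2 * t ^ 2 ≤ 5 * (t - 1) ^ 2 := by nlinarith
    have h3 : 2 * t ^ 2 * Real.log t ≤ 2 * t ^ 2 * Real.log N :=
      mul_le_mul_of_nonneg_left h1 (by positivity)
    have h4 : 2 * t ^ 2 * Real.log N ≤ 5 * (t - 1) ^ 2 * Real.log N :=
      mul_le_mul_of_nonneg_right h2 (by linarith)
    nlinarith

/-- A logarithmic Sobolev inequality for the trivial chain: if every atom of `w` has relative mass
at least `p`, the entropy of `F` is at most `5 log (1 / p)` times the variance of `√F`. -/
theorem wEnt_le_log_mul_variance {α : Type*} (s : Finset α) (w F : α → ℝ)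
    (hw : ∀ x ∈ s, 0 ≤ w x) (hW : 0 < ∑ x ∈ s, w x) (hF : ∀ x ∈ s, 0 < F x) {p : ℝ} (hp : 0 < p)
    (hp4 : p ≤ 1 / 4) (hatom : ∀ x ∈ s, w x = 0 ∨ p * ∑ y ∈ s, w y ≤ w x) (a : ℝ) :
    wEnt s w F ≤ 5 * Real.log (1 / p) * ∑ x ∈ s, w x * (Real.sqrt (F x) - a) ^ 2 := by
  set W := ∑ x ∈ s, w x with hWdef
  set B := ∑ x ∈ s, w x * Real.sqrt (F x) with hB
  have hBpos : 0 < B := by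
    obtain ⟨x, hx, hwx⟩ := (Finset.sum_pos_iff_of_nonneg hw).1 hW
    exact Finset.sum_pos' (fun x hx => mul_nonneg (hw x hx) (Real.sqrt_nonneg _))
      ⟨x, hx, mul_pos hwx (Real.sqrt_pos.2 (hF x hx))⟩
  set c := B / W with hc
  have hcpos : 0 < c := div_pos hBpos hW
  have hN : 4 ≤ 1 / p := by rw [le_div_iff₀ hp]; linarith
  have hlog : 0 ≤ Real.log (1 / p) := Real.log_nonneg (by linarith)
  refine (wEnt_le s w F hw hW hF (c := c ^ 2) (by positivity)).trans ?_
  have hpt : ∀ x ∈ s, w x * (F x * Real.log (F x / c ^ 2) - F x + c ^ 2)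
      ≤ w x * (5 * Real.log (1 / p) * (Real.sqrt (F x) - c) ^ 2) := by
    intro x hx
    rcases hatom x hx with h0 | hpx
    · simp [h0]
    · refine mul_le_mul_of_nonneg_left ?_ (hw x hx)
      set u := Real.sqrt (F x) with hu
      have hupos : 0 < u := Real.sqrt_pos.2 (hF x hx)
      have hFu : F x = u ^ 2 := (Real.sq_sqrt (hF x hx).le).symm
      have hle : w x * u ≤ B :=
        Finset.single_le_sum (f := fun y => w y * Real.sqrt (F y))
          (fun y hy => mul_nonneg (hw y hy) (Real.sqrt_nonneg _)) hx
      have htN : u / c ≤ 1 / p := by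
        rw [hc, div_div_eq_mul_div, div_le_div_iff₀ hBpos hp]
        nlinarith [mul_le_mul_of_nonneg_right hpx hupos.le]
      have key := two_mul_sq_mul_log_le hN (div_pos hupos hcpos) htN
      have h2 : F x / c ^ 2 = (u / c) ^ 2 := by rw [hFu, ← div_pow]
      rw [h2, Real.log_pow, hFu]
      have h3 := mul_le_mul_of_nonneg_left key (sq_nonneg c)
      have h4 : c ^ 2 * (2 * (u / c) ^ 2 * Real.log (u / c) - (u / c) ^ 2 + 1)
          = u ^ 2 * ((2 : ℕ) * Real.log (u / c)) - u ^ 2 + c ^ 2 := by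
        field_simp
        push_cast
        ring
      have h5 : c ^ 2 * (5 * Real.log (1 / p) * (u / c - 1) ^ 2)
          = 5 * Real.log (1 / p) * (u - c) ^ 2 := by
        field_simp
      linarith
  refine (Finset.sum_le_sum hpt).trans ?_
  have h1 : ∑ x ∈ s, w x * (5 * Real.log (1 / p) * (Real.sqrt (F x) - c) ^ 2)
      = 5 * Real.log (1 / p) * ∑ x ∈ s, w x * (Real.sqrt (F x) - c) ^ 2 := by
    rw [Finset.mul_sum]
    exact Finset.sum_congr rfl fun x _ => by ring
  rw [h1]
  refine mul_le_mul_of_nonneg_left ?_ (by positivity)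
  -- the mean `c` of `√F` minimises the quadratic deviation
  have h2 : ∑ x ∈ s, w x * (Real.sqrt (F x) - a) ^ 2 - ∑ x ∈ s, w x * (Real.sqrt (F x) - c) ^ 2
      = 2 * (c - a) * B + (a ^ 2 - c ^ 2) * W := by
    rw [hB, hWdef, Finset.mul_sum, Finset.mul_sum, ← Finset.sum_sub_distrib,
      ← Finset.sum_add_distrib]
    exact Finset.sum_congr rfl fun x _ => by ring
  have h3 : B = c * W := by rw [hc]; field_simp
  rw [h3] at h2
  nlinarith [mul_nonneg (sq_nonneg (c - a)) hW.le]

end MeanField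

/-! ### Birth–death chains -/

namespace MeanField

/-- Data of a reversible birth–death chain on `{0, …, M}`: a reversing measure `W`, birth rates `b`
and death rates `d`, such that `d` increases by at least `δ` at each step while `b` does not
increase. The number `ε` is a time step, small enough for one step of length `ε` to be a lazy
Markov kernel and for two neighbouring copies to be coupled without crossing. Only the values on
`{0, …, M}` matter; the sign conditions are imposed everywhere to avoid side conditions. -/
structure BirthDeath (M : ℕ) (W b d : ℕ → ℝ) (δ ε : ℝ) : Prop where
  weight_pos : ∀ k, 0 < W k
  birth_nonneg : ∀ k, 0 ≤ b k
  death_nonneg : ∀ k, 0 ≤ d k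
  balance : ∀ k < M, W k * b k = W (k + 1) * d (k + 1)
  death_zero : d 0 = 0
  birth_top : b M = 0
  birth_anti : ∀ k < M, b (k + 1) ≤ b k
  death_incr : ∀ k < M, δ ≤ d (k + 1) - d k
  incr_pos : 0 < δ
  step_pos : 0 < ε
  lazy : ∀ k, ε * (b k + d k) ≤ 1 / 2
  no_crossing : ∀ k < M, ε * (b k + d (k + 1)) ≤ 1

/-- One step, of length `ε`, of the birth–death chain with rates `b` and `d`. -/
def bdStep (ε : ℝ) (b d f : ℕ → ℝ) (k : ℕ) : ℝ :=
  f k + ε * (b k * (f (k + 1) - f k) + d k * (f (k - 1) - f k))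

/-- The Dirichlet form of a birth–death chain at `(√f, √f)`, with respect to the measure `W`, which
need not have mass one. -/
noncomputable def bdEnergy (M : ℕ) (W b f : ℕ → ℝ) : ℝ :=
  ∑ k ∈ Finset.range M, W k * b k * sqDist (f k) (f (k + 1))

namespace BirthDeath

variable {M : ℕ} {W b d : ℕ → ℝ} {δ ε : ℝ}

theorem step_fun_pos (h : BirthDeath M W b d δ ε) {f : ℕ → ℝ} (hf : ∀ k, 0 < f k) (k : ℕ) :
    0 < bdStep ε b d f k := by
  have h1 : bdStep ε b d f k
      = ε * b k * f (k + 1) + ε * d k * f (k - 1) + (1 - ε * (b k + d k)) * f k := by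
    unfold bdStep; ring
  rw [h1]
  have h2 := mul_nonneg (mul_nonneg h.step_pos.le (h.birth_nonneg k)) (hf (k + 1)).le
  have h3 := mul_nonneg (mul_nonneg h.step_pos.le (h.death_nonneg k)) (hf (k - 1)).le
  have h4 : 0 < (1 - ε * (b k + d k)) * f k :=
    mul_pos (by linarith [h.lazy k]) (hf k)
  linarith

/-- Sums over the downward edges of the chain are sums over the upward edges. -/
theorem sum_death (h : BirthDeath M W b d δ ε) (φ : ℕ → ℝ) :
    ∑ k ∈ Finset.range (M + 1), W k * d k * φ k
      = ∑ k ∈ Finset.range M, W k * b k * φ (k + 1) := by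
  rw [Finset.sum_range_succ', h.death_zero]
  simp only [mul_zero, zero_mul, add_zero]
  refine Finset.sum_congr rfl fun k hk => ?_
  rw [h.balance k (Finset.mem_range.1 hk)]

theorem sum_birth (h : BirthDeath M W b d δ ε) (φ : ℕ → ℝ) :
    ∑ k ∈ Finset.range (M + 1), W k * b k * φ k = ∑ k ∈ Finset.range M, W k * b k * φ k := by
  rw [Finset.sum_range_succ, h.birth_top]; simp

theorem sum_step (h : BirthDeath M W b d δ ε) (f : ℕ → ℝ) :
    ∑ k ∈ Finset.range (M + 1), W k * bdStep ε b d f k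
      = ∑ k ∈ Finset.range (M + 1), W k * f k := by
  have h1 := h.sum_death (fun k => f (k - 1) - f k)
  have h2 := h.sum_birth (fun k => f (k + 1) - f k)
  have h3 : ∑ k ∈ Finset.range (M + 1), W k * bdStep ε b d f k
      = ∑ k ∈ Finset.range (M + 1), W k * f k
        + ε * (∑ k ∈ Finset.range (M + 1), W k * b k * (f (k + 1) - f k)
          + ∑ k ∈ Finset.range (M + 1), W k * d k * (f (k - 1) - f k)) := by
    rw [← Finset.sum_add_distrib, Finset.mul_sum, ← Finset.sum_add_distrib]
    refine Finset.sum_congr rfl fun k _ => ?_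
    unfold bdStep; ring
  have h4 : ∑ k ∈ Finset.range M, W k * b k * (f (k + 1) - f k)
      + ∑ k ∈ Finset.range M, W k * b k * (f (k + 1 - 1) - f (k + 1)) = 0 := by
    rw [← Finset.sum_add_distrib]
    refine Finset.sum_eq_zero fun k _ => ?_
    rw [Nat.add_sub_cancel]; ring
  rw [h3, h1, h2, h4, mul_zero, add_zero]

/-- Two copies of the chain started from neighbouring points either move together or meet, and they
meet at rate at least `δ`: the energy contracts. -/
theorem energy_step_le (h : BirthDeath M W b d δ ε) {f : ℕ → ℝ} (hf : ∀ k, 0 < f k) :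
    bdEnergy M W b (bdStep ε b d f) ≤ (1 - ε * δ) * bdEnergy M W b f := by
  have hε := h.step_pos
  have hpt : ∀ k ∈ Finset.range M,
      W k * b k * sqDist (bdStep ε b d f k) (bdStep ε b d f (k + 1))
        ≤ W k * b k * (ε * b (k + 1) * sqDist (f (k + 1)) (f (k + 2)))
          + W k * b k * (ε * d k * sqDist (f (k - 1)) (f k))
          + W k * b k * ((1 - ε * (b k + d (k + 1))) * sqDist (f k) (f (k + 1))) := by
    intro k hk
    have hkM := Finset.mem_range.1 hk
    rw [← mul_add, ← mul_add]
    refine mul_le_mul_of_nonneg_left ?_ (mul_nonneg (h.weight_pos k).le (h.birth_nonneg k))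
    have hb := h.birth_anti k hkM
    have hd := h.death_incr k hkM
    have hδ := h.incr_pos
    have hcr := h.no_crossing k hkM
    have hb1 := h.birth_nonneg (k + 1)
    have hd1 := h.death_nonneg k
    have key := sqDist_sum_le (Finset.univ : Finset (Fin 5))
      ![ε * b (k + 1), ε * d k, 1 - ε * (b k + d (k + 1)), ε * (b k - b (k + 1)),
        ε * (d (k + 1) - d k)]
      ![f (k + 1), f (k - 1), f k, f (k + 1), f k]
      ![f (k + 2), f k, f (k + 1), f (k + 1), f k]
      (by
        intro x _
        fin_cases x
        · exact mul_nonneg hε.le hb1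
        · exact mul_nonneg hε.le hd1
        · exact sub_nonneg.2 hcr
        · exact mul_nonneg hε.le (sub_nonneg.2 hb)
        · exact mul_nonneg hε.le (by linarith))
      (by intro x _; fin_cases x <;> exact (hf _).le)
      (by intro x _; fin_cases x <;> exact (hf _).le)
    simp only [Fin.sum_univ_five, Matrix.cons_val, sqDist_self, mul_zero, add_zero] at key
    have e1 : bdStep ε b d f k = ε * b (k + 1) * f (k + 1) + ε * d k * f (k - 1)
        + (1 - ε * (b k + d (k + 1))) * f k + ε * (b k - b (k + 1)) * f (k + 1)
        + ε * (d (k + 1) - d k) * f k := by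
      unfold bdStep; ring
    have e2 : bdStep ε b d f (k + 1) = ε * b (k + 1) * f (k + 2) + ε * d k * f k
        + (1 - ε * (b k + d (k + 1))) * f (k + 1) + ε * (b k - b (k + 1)) * f (k + 1)
        + ε * (d (k + 1) - d k) * f k := by
      unfold bdStep; rw [Nat.add_sub_cancel]; ring
    rw [e1, e2]
    exact key
  unfold bdEnergy
  refine (Finset.sum_le_sum hpt).trans ?_
  rw [Finset.sum_add_distrib, Finset.sum_add_distrib]
  have s1 : ∑ k ∈ Finset.range M, W k * b k * (ε * b (k + 1) * sqDist (f (k + 1)) (f (k + 2)))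
      = ∑ k ∈ Finset.range M, W k * b k * (ε * d k * sqDist (f k) (f (k + 1))) := by
    rw [← h.sum_death (fun k => ε * b k * sqDist (f k) (f (k + 1))), ← h.sum_birth]
    exact Finset.sum_congr rfl fun k _ => by ring
  have s2 : ∑ k ∈ Finset.range M, W k * b k * (ε * d k * sqDist (f (k - 1)) (f k))
      = ∑ k ∈ Finset.range M, W k * b k * (ε * b (k + 1) * sqDist (f k) (f (k + 1))) := by
    have := h.sum_death (fun k => ε * b k * sqDist (f (k - 1)) (f k))
    simp only [Nat.add_sub_cancel] at this
    rw [← this, ← h.sum_birth]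
    exact Finset.sum_congr rfl fun k _ => by ring
  rw [s1, s2, ← Finset.sum_add_distrib, ← Finset.sum_add_distrib, Finset.mul_sum]
  refine Finset.sum_le_sum fun k hk => ?_
  have hkM := Finset.mem_range.1 hk
  have hw : 0 ≤ W k * b k * sqDist (f k) (f (k + 1)) :=
    mul_nonneg (mul_nonneg (h.weight_pos k).le (h.birth_nonneg k)) (sqDist_nonneg _ _)
  have hco : 0 ≤ ε * (d (k + 1) - d k - δ + (b k - b (k + 1))) :=
    mul_nonneg hε.le (by linarith [h.birth_anti k hkM, h.death_incr k hkM])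
  linarith [mul_nonneg hco hw]

/-- The entropy lost in one step is an average of the entropies of the three-point transition
measures, so the inequality for measures with bounded atoms applies. -/
theorem wEnt_le_step (h : BirthDeath M W b d δ ε) {p : ℝ} (hp : 0 < p) (hp4 : p ≤ 1 / 4)
    (hpb : ∀ k < M, p ≤ ε * b k) (hpd : ∀ k < M, p ≤ ε * d (k + 1)) {f : ℕ → ℝ}
    (hf : ∀ k, 0 < f k) :
    wEnt (Finset.range (M + 1)) W f ≤ wEnt (Finset.range (M + 1)) W (bdStep ε b d f)
      + 10 * ε * Real.log (1 / p) * bdEnergy M W b f := by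
  have hε := h.step_pos
  set L := Real.log (1 / p) with hL
  have hloc : ∀ k ∈ Finset.range (M + 1),
      W k * (bdStep ε b d (fun j => f j * Real.log (f j)) k
        - bdStep ε b d f k * Real.log (bdStep ε b d f k))
      ≤ 5 * L * ε * (W k * b k * sqDist (f k) (f (k + 1))
        + W k * d k * sqDist (f (k - 1)) (f k)) := by
    intro k hk
    have hkM : k ≤ M := Nat.lt_succ_iff.1 (Finset.mem_range.1 hk)
    have hlz := h.lazy k
    have hb1 := mul_nonneg hε.le (h.birth_nonneg k)
    have hd1 := mul_nonneg hε.le (h.death_nonneg k)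
    have hsum : ∑ x : Fin 3, ![ε * b k, ε * d k, 1 - ε * (b k + d k)] x = 1 := by
      simp only [Fin.sum_univ_three, Matrix.cons_val]; ring
    have key := wEnt_le_log_mul_variance (Finset.univ : Finset (Fin 3))
      ![ε * b k, ε * d k, 1 - ε * (b k + d k)] ![f (k + 1), f (k - 1), f k]
      (by
        intro x _
        fin_cases x
        · exact hb1
        · exact hd1
        · change 0 ≤ 1 - ε * (b k + d k)
          linarith)
      (by rw [hsum]; exact one_pos)
      (by intro x _; fin_cases x <;> exact hf _) hp hp4
      (by
        intro x _
        rw [hsum, mul_one]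
        fin_cases x
        · rcases hkM.lt_or_eq with hlt | heq
          · exact Or.inr (hpb k hlt)
          · left
            change ε * b k = 0
            rw [heq, h.birth_top, mul_zero]
        · rcases Nat.eq_zero_or_pos k with h0 | hpos
          · left
            change ε * d k = 0
            rw [h0, h.death_zero, mul_zero]
          · right
            obtain ⟨j, rfl⟩ := Nat.exists_eq_succ_of_ne_zero hpos.ne'
            exact hpd j hkM
        · right
          change p ≤ 1 - ε * (b k + d k)
          linarith)
      (Real.sqrt (f k))
    unfold wEnt at key
    rw [hsum, div_one] at key
    simp only [Fin.sum_univ_three, Matrix.cons_val, sub_self] at key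
    have e1 : bdStep ε b d f k
        = ε * b k * f (k + 1) + ε * d k * f (k - 1) + (1 - ε * (b k + d k)) * f k := by
      unfold bdStep; ring
    have e2 : bdStep ε b d (fun j => f j * Real.log (f j)) k
        = ε * b k * (f (k + 1) * Real.log (f (k + 1)))
          + ε * d k * (f (k - 1) * Real.log (f (k - 1)))
          + (1 - ε * (b k + d k)) * (f k * Real.log (f k)) := by
      unfold bdStep; ring
    rw [← e1, ← e2] at key
    have hmul := mul_le_mul_of_nonneg_left key (h.weight_pos k).le
    rw [sqDist_comm (f k)]
    unfold sqDist
    linarith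
  have hsum := Finset.sum_le_sum hloc
  rw [← Finset.mul_sum, Finset.sum_add_distrib,
    h.sum_birth (fun k => sqDist (f k) (f (k + 1))),
    h.sum_death (fun k => sqDist (f (k - 1)) (f k))] at hsum
  simp only [Nat.add_sub_cancel, mul_sub, Finset.sum_sub_distrib] at hsum
  rw [h.sum_step] at hsum
  unfold wEnt
  rw [h.sum_step]
  unfold bdEnergy
  linarith

/-- A logarithmic Sobolev inequality with a non-explicit constant, obtained by summing the gradient
of `√f` along the segment. -/
theorem exists_wEnt_le (h : BirthDeath M W b d δ ε) (hb : ∀ k < M, 0 < b k) :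
    ∃ T : ℝ, ∀ f : ℕ → ℝ, (∀ k, 0 < f k) →
      wEnt (Finset.range (M + 1)) W f ≤ T * bdEnergy M W b f := by
  set V := ∑ k ∈ Finset.range (M + 1), W k with hV
  have hVpos : 0 < V := Finset.sum_pos (fun k _ => h.weight_pos k) ⟨0, by simp⟩
  obtain ⟨w, hw, hwle⟩ : ∃ w : ℝ, 0 < w ∧ ∀ k ∈ Finset.range (M + 1), w ≤ W k := by
    refine ⟨(Finset.range (M + 1)).inf' ⟨0, by simp⟩ W, ?_, fun k hk => Finset.inf'_le _ hk⟩
    exact (Finset.lt_inf'_iff _).2 fun k _ => h.weight_pos k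
  obtain ⟨v, hv, hvle⟩ : ∃ v : ℝ, 0 < v ∧ ∀ k ∈ Finset.range M, v ≤ W k * b k := by
    rcases (Finset.range M).eq_empty_or_nonempty with he | hne
    · exact ⟨1, one_pos, by simp [he]⟩
    · refine ⟨(Finset.range M).inf' hne fun k => W k * b k, ?_, fun k hk => Finset.inf'_le _ hk⟩
      exact (Finset.lt_inf'_iff _).2 fun k hk =>
        mul_pos (h.weight_pos k) (hb k (Finset.mem_range.1 hk))
  set p := min (1 / 4) (w / V) with hpdef
  have hp : 0 < p := lt_min (by norm_num) (div_pos hw hVpos)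
  have hlog : 0 ≤ Real.log (1 / p) :=
    Real.log_nonneg (by
      rw [le_div_iff₀ hp]
      linarith [min_le_left (1 / 4 : ℝ) (w / V)])
  refine ⟨5 * Real.log (1 / p) * (V * (M * v⁻¹)), fun f hf => ?_⟩
  have h1 := wEnt_le_log_mul_variance (Finset.range (M + 1)) W f (fun k _ => (h.weight_pos k).le)
    hVpos (fun k _ => hf k) hp (min_le_left _ _)
    (fun k hk => Or.inr (by
      have h2 : p ≤ w / V := min_le_right _ _
      rw [le_div_iff₀ hVpos] at h2
      exact h2.trans (hwle k hk)))
    (Real.sqrt (f 0))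
  refine h1.trans ?_
  rw [mul_assoc (5 * Real.log (1 / p))]
  refine mul_le_mul_of_nonneg_left ?_ (by positivity)
  rw [hV, Finset.sum_mul, Finset.sum_mul]
  refine Finset.sum_le_sum fun k hk => ?_
  rw [mul_assoc]
  refine mul_le_mul_of_nonneg_left ?_ (h.weight_pos k).le
  have hkM : k ≤ M := Nat.lt_succ_iff.1 (Finset.mem_range.1 hk)
  have htel : Real.sqrt (f k) - Real.sqrt (f 0)
      = ∑ j ∈ Finset.range k, (Real.sqrt (f (j + 1)) - Real.sqrt (f j)) :=
    (Finset.sum_range_sub (fun j => Real.sqrt (f j)) k).symm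
  have hE : ∑ j ∈ Finset.range M, sqDist (f j) (f (j + 1)) ≤ v⁻¹ * bdEnergy M W b f := by
    unfold bdEnergy
    rw [Finset.mul_sum]
    refine Finset.sum_le_sum fun j hj => ?_
    rw [← mul_assoc]
    refine le_mul_of_one_le_left (sqDist_nonneg _ _) ?_
    rw [inv_mul_eq_div, one_le_div hv]
    exact hvle j hj
  have hcs := sq_sum_le_card_mul_sum_sq (s := Finset.range k)
    (f := fun j => Real.sqrt (f (j + 1)) - Real.sqrt (f j))
  rw [Finset.card_range] at hcs
  have hmono : ∑ j ∈ Finset.range k, (Real.sqrt (f (j + 1)) - Real.sqrt (f j)) ^ 2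
      ≤ ∑ j ∈ Finset.range M, sqDist (f j) (f (j + 1)) := by
    refine (Finset.sum_le_sum_of_subset_of_nonneg (Finset.range_subset_range.2 hkM)
      fun _ _ _ => sq_nonneg _).trans (le_of_eq ?_)
    exact Finset.sum_congr rfl fun j _ => by rw [sqDist_comm]; rfl
  rw [htel, mul_assoc]
  refine hcs.trans (mul_le_mul (by exact_mod_cast hkM) (hmono.trans hE)
    (Finset.sum_nonneg fun _ _ => sq_nonneg _) (by positivity))

/-- The logarithmic Sobolev inequality for birth–death chains: the entropy decreases along the
iterates of the one-step kernel by amounts controlled by the energy, and the energies decay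
geometrically. -/
theorem wEnt_le (h : BirthDeath M W b d δ ε) {p : ℝ} (hp : 0 < p) (hp4 : p ≤ 1 / 4)
    (hpb : ∀ k < M, p ≤ ε * b k) (hpd : ∀ k < M, p ≤ ε * d (k + 1)) {f : ℕ → ℝ}
    (hf : ∀ k, 0 < f k) :
    wEnt (Finset.range (M + 1)) W f ≤ 10 * Real.log (1 / p) / δ * bdEnergy M W b f := by
  have hε := h.step_pos
  have hδ := h.incr_pos
  have hlog : 0 ≤ Real.log (1 / p) := Real.log_nonneg (by
    rw [le_div_iff₀ hp]
    linarith)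
  rcases Nat.eq_zero_or_pos M with hM0 | hM
  · subst hM0
    obtain ⟨T, hT⟩ := h.exists_wEnt_le (by simp)
    simpa [bdEnergy] using hT f hf
  have hb : ∀ k < M, 0 < b k := fun k hk =>
    (mul_pos_iff_of_pos_left hε).1 (hp.trans_le (hpb k hk))
  obtain ⟨T, hT⟩ := h.exists_wEnt_le hb
  set C := 10 * Real.log (1 / p) / δ with hC
  set θ := 1 - ε * δ with hθ
  have hθ1 : θ < 1 := by
    have := mul_pos hε hδ
    linarith
  have hθ0 : 0 ≤ θ := by
    have h1 := h.death_incr 0 hM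
    rw [h.death_zero, sub_zero] at h1
    have h2 := h.lazy 1
    have h3 := mul_nonneg hε.le (h.birth_nonneg 1)
    have h4 := mul_le_mul_of_nonneg_left h1 hε.le
    rw [zero_add] at h4
    rw [mul_add] at h2
    linarith
  -- after `t` steps the non-explicit constant has weight `θ ^ t`
  have hiter : ∀ t : ℕ, ∀ g : ℕ → ℝ, (∀ k, 0 < g k) →
      wEnt (Finset.range (M + 1)) W g
        ≤ (max T 0 * θ ^ t + C * (1 - θ ^ t)) * bdEnergy M W b g := by
    have hE : ∀ g : ℕ → ℝ, 0 ≤ bdEnergy M W b g := fun g =>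
      Finset.sum_nonneg fun k _ =>
        mul_nonneg (mul_nonneg (h.weight_pos k).le (h.birth_nonneg k)) (sqDist_nonneg _ _)
    have hC0 : 0 ≤ C := by positivity
    intro t
    induction t with
    | zero =>
      intro g hg
      simp only [pow_zero, mul_one, sub_self, mul_zero, add_zero]
      exact (hT g hg).trans (mul_le_mul_of_nonneg_right (le_max_left _ _) (hE g))
    | succ t ih =>
      intro g hg
      have h1 := h.wEnt_le_step hp hp4 hpb hpd hg
      have h2 := ih _ (h.step_fun_pos hg)
      have hco : 0 ≤ max T 0 * θ ^ t + C * (1 - θ ^ t) :=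
        add_nonneg (mul_nonneg (le_max_right _ _) (pow_nonneg hθ0 t))
          (mul_nonneg hC0 (sub_nonneg.2 (pow_le_one₀ hθ0 hθ1.le)))
      have h3 := mul_le_mul_of_nonneg_left (h.energy_step_le hg) hco
      have h4 : 10 * ε * Real.log (1 / p) = C * (1 - θ) := by
        rw [hC, hθ]; field_simp; ring
      rw [h4] at h1
      rw [pow_succ]
      linarith
  have hlim : Filter.Tendsto
      (fun t : ℕ => (max T 0 * θ ^ t + C * (1 - θ ^ t)) * bdEnergy M W b f) Filter.atTop
      (nhds ((max T 0 * 0 + C * (1 - 0)) * bdEnergy M W b f)) := by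
    have hpow := tendsto_pow_atTop_nhds_zero_of_lt_one hθ0 hθ1
    exact ((hpow.const_mul _).add ((hpow.const_sub 1).const_mul C)).mul_const _
  have := ge_of_tendsto' hlim fun t => hiter t f hf
  simpa using this

end BirthDeath

end MeanField

/-! ### Configurations and product weights -/

namespace MeanField

section Configurations

variable {ι : Type*} [DecidableEq ι]

theorem add_single_mem {S : Finset ι} {N : ℕ} {x : ι → ℕ} (hx : x ∈ S.piAntidiag N) {i : ι}
    (hi : i ∈ S) (k : ℕ) : x + Pi.single i k ∈ S.piAntidiag (N + k) := by
  rw [Finset.mem_piAntidiag] at hx ⊢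
  refine ⟨?_, fun j hj => ?_⟩
  · rw [← hx.1]
    simp [Finset.sum_add_distrib, hi]
  · by_cases hji : j = i
    · exact hji ▸ hi
    · exact hx.2 j (by simpa [hji] using hj)

theorem exists_eq_add_single {S : Finset ι} {N : ℕ} {x : ι → ℕ} (hx : x ∈ S.piAntidiag (N + 1))
    {i : ι} (hi : x i ≠ 0) : ∃ w ∈ S.piAntidiag N, x = w + Pi.single i 1 := by
  have hle : (Pi.single i 1 : ι → ℕ) ≤ x := by
    intro j
    by_cases hj : j = i
    · subst hj; simp; omega
    · simp [hj]
  have hxw : x = x - Pi.single i 1 + Pi.single i 1 := (tsub_add_cancel_of_le hle).symm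
  rw [Finset.mem_piAntidiag] at hx
  refine ⟨x - Pi.single i 1, ?_, hxw⟩
  rw [Finset.mem_piAntidiag]
  constructor
  · have h1 := hx.1
    rw [hxw] at h1
    simp only [Pi.add_apply, Finset.sum_add_distrib] at h1
    have h2 : ∑ j ∈ S, (Pi.single i 1 : ι → ℕ) j = 1 := by simp [hx.2 i hi]
    rw [h2] at h1
    simpa using h1
  · intro j hj
    refine hx.2 j fun h0 => hj ?_
    simp [h0]

theorem eq_zero_of_mem_erase {S : Finset ι} {i : ι} {N : ℕ} {y : ι → ℕ}
    (hy : y ∈ (S.erase i).piAntidiag N) : y i = 0 := by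
  by_contra hne
  exact Finset.notMem_erase i S ((Finset.mem_piAntidiag.1 hy).2 i hne)

/-- Conditioning on the number of particles at the site `i`. -/
theorem sum_piAntidiag_eq_sum_erase {S : Finset ι} {i : ι} (hi : i ∈ S) (N : ℕ)
    (Ψ : (ι → ℕ) → ℝ) :
    ∑ x ∈ S.piAntidiag N, Ψ x
      = ∑ k ∈ Finset.range (N + 1), ∑ y ∈ (S.erase i).piAntidiag (N - k),
          Ψ (y + Pi.single i k) := by
  rw [Finset.sum_sigma']
  refine Finset.sum_bij' (fun x _ => ⟨x i, Function.update x i 0⟩)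
    (fun z _ => z.2 + Pi.single i z.1) ?_ ?_ ?_ ?_ ?_
  · intro x hx
    rw [Finset.mem_piAntidiag] at hx
    have hsum : x i + ∑ j ∈ S.erase i, x j = N := by rw [Finset.add_sum_erase _ _ hi]; exact hx.1
    simp only [Finset.mem_sigma, Finset.mem_range, Finset.mem_piAntidiag, Finset.mem_erase]
    refine ⟨by omega, ?_, fun j hj => ?_⟩
    · exact (Finset.sum_congr rfl fun j hj =>
        Function.update_of_ne (Finset.ne_of_mem_erase hj) (0 : ℕ) x).trans
          (by omega : ∑ j ∈ S.erase i, x j = N - x i)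
    · by_cases hji : j = i
      · simp [hji] at hj
      · exact ⟨hji, hx.2 j (by simpa [hji] using hj)⟩
  · rintro ⟨k, y⟩ hz
    simp only [Finset.mem_sigma, Finset.mem_range] at hz
    have hy : y ∈ S.piAntidiag (N - k) := by
      rw [Finset.mem_piAntidiag] at hz ⊢
      refine ⟨?_, fun j hj => Finset.mem_of_mem_erase (hz.2.2 j hj)⟩
      rw [← Finset.add_sum_erase _ _ hi, hz.2.1]
      have : y i = 0 := by
        by_contra hne
        exact Finset.notMem_erase i S (hz.2.2 i hne)
      rw [this, zero_add]
    have := add_single_mem hy hi k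
    rwa [Nat.sub_add_cancel (by omega)] at this
  · intro x _
    funext j
    by_cases hji : j = i
    · subst hji; simp
    · simp [hji]
  · rintro ⟨k, y⟩ hz
    simp only [Finset.mem_sigma, Finset.mem_range, Finset.mem_piAntidiag] at hz
    have hyi : y i = 0 := by
      by_contra hne
      exact Finset.notMem_erase i S (hz.2.2 i hne)
    have h1 : (y + Pi.single i k : ι → ℕ) i = k := by simp [hyi]
    have h2 : Function.update (y + Pi.single i k : ι → ℕ) i 0 = y := by
      funext j
      by_cases hji : j = i
      · subst hji; simp [hyi]
      · simp [hji]
    simp only [h1, h2]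
  · intro x _
    congr 1
    funext j
    by_cases hji : j = i
    · subst hji; simp
    · simp [hji]

theorem piAntidiag_nonempty {S : Finset ι} (hS : S.Nonempty) (N : ℕ) :
    (S.piAntidiag N).Nonempty := by
  obtain ⟨i, hi⟩ := hS
  refine ⟨Pi.single i N, ?_⟩
  have := add_single_mem (x := 0) (N := 0) (by simp) hi N
  simpa using this

end Configurations

/-- No particle leaves an empty site, and the increments of all the rate functions lie in `[δ, Δ]`,
where `δ > 0`. -/
structure RateBounds {ι : Type*} (r : ι → ℕ → ℝ) (δ Δ : ℝ) : Prop where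
  pos : 0 < δ
  zero : ∀ i, r i 0 = 0
  incr : ∀ i k, δ ≤ r i (k + 1) - r i k ∧ r i (k + 1) - r i k ≤ Δ

namespace RateBounds

variable {ι : Type*} {r : ι → ℕ → ℝ} {δ Δ : ℝ}

theorem mul_le (h : RateBounds r δ Δ) (i : ι) (k : ℕ) : δ * k ≤ r i k := by
  induction k with
  | zero => simp [h.zero i]
  | succ k ih => push_cast; linarith [(h.incr i k).1]

theorem le_mul (h : RateBounds r δ Δ) (i : ι) (k : ℕ) : r i k ≤ Δ * k := by
  induction k with
  | zero => simp [h.zero i]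
  | succ k ih => push_cast; linarith [(h.incr i k).2]

theorem nonneg (h : RateBounds r δ Δ) (i : ι) (k : ℕ) : 0 ≤ r i k :=
  (mul_nonneg h.pos.le k.cast_nonneg).trans (h.mul_le i k)

theorem succ_pos (h : RateBounds r δ Δ) (i : ι) (k : ℕ) : 0 < r i (k + 1) := by
  linarith [h.nonneg i k, (h.incr i k).1, h.pos]

theorem le (h : RateBounds r δ Δ) (i : ι) : δ ≤ Δ := (h.incr i 0).1.trans (h.incr i 0).2

end RateBounds

variable {ι : Type*}

/-- The weight `1 / (ρ(1) ⋯ ρ(k))` of `k` particles at a site with rate function `ρ`. -/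
noncomputable def siteWeight (ρ : ℕ → ℝ) (k : ℕ) : ℝ := ∏ l ∈ Finset.range k, (ρ (l + 1))⁻¹

theorem RateBounds.siteWeight_pos {r : ι → ℕ → ℝ} {δ Δ : ℝ} (h : RateBounds r δ Δ) (i : ι) (k : ℕ) :
    0 < siteWeight (r i) k :=
  Finset.prod_pos fun l _ => inv_pos.2 (h.succ_pos i l)

variable [Fintype ι] {r : ι → ℕ → ℝ} {δ Δ : ℝ}

/-- The product weight of a configuration; conditioned on the number of particles it is the
reversible measure of the zero-range process. -/
noncomputable def weight (r : ι → ℕ → ℝ) (x : ι → ℕ) : ℝ := ∏ i, siteWeight (r i) (x i)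

theorem RateBounds.weight_pos (h : RateBounds r δ Δ) (x : ι → ℕ) : 0 < weight r x :=
  Finset.prod_pos fun i _ => h.siteWeight_pos i (x i)

variable [DecidableEq ι]

/-- The total weight of the configurations of `N` particles on the sites of `S`. -/
noncomputable def partitionFn (r : ι → ℕ → ℝ) (S : Finset ι) (N : ℕ) : ℝ :=
  ∑ x ∈ S.piAntidiag N, weight r x

theorem weight_eq_mul_prod_erase (r : ι → ℕ → ℝ) (x : ι → ℕ) (i : ι) :
    weight r x = siteWeight (r i) (x i) * ∏ j ∈ Finset.univ.erase i, siteWeight (r j) (x j) :=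
  (Finset.mul_prod_erase _ _ (Finset.mem_univ i)).symm

theorem prod_erase_add_single (r : ι → ℕ → ℝ) (x : ι → ℕ) (i : ι) (k : ℕ) :
    ∏ j ∈ Finset.univ.erase i, siteWeight (r j) ((x + Pi.single i k : ι → ℕ) j)
      = ∏ j ∈ Finset.univ.erase i, siteWeight (r j) (x j) := by
  refine Finset.prod_congr rfl fun j hj => ?_
  simp [Finset.ne_of_mem_erase hj]

theorem RateBounds.weight_add_single_one (h : RateBounds r δ Δ) (x : ι → ℕ) (i : ι) :
    weight r (x + Pi.single i 1) * r i (x i + 1) = weight r x := by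
  rw [weight_eq_mul_prod_erase r _ i, prod_erase_add_single, weight_eq_mul_prod_erase r x i]
  have h1 : (x + Pi.single i 1 : ι → ℕ) i = x i + 1 := by simp
  rw [h1, siteWeight, Finset.prod_range_succ, ← siteWeight]
  have := (h.succ_pos i (x i)).ne'
  field_simp

theorem weight_add_single_of_eq_zero (r : ι → ℕ → ℝ) {x : ι → ℕ} {i : ι} (hx : x i = 0) (k : ℕ) :
    weight r (x + Pi.single i k) = siteWeight (r i) k * weight r x := by
  rw [weight_eq_mul_prod_erase r _ i, prod_erase_add_single, weight_eq_mul_prod_erase r x i]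
  have h1 : (x + Pi.single i k : ι → ℕ) i = k := by simp [hx]
  have h2 : siteWeight (r i) 0 = 1 := by simp [siteWeight]
  rw [h1, hx, h2, one_mul]

/-- Summing over configurations with a particle removed at `i`, at rate `r i`, amounts to summing
over configurations with one particle less. -/
theorem RateBounds.sum_weight_mul_rate (h : RateBounds r δ Δ) {S : Finset ι} {i : ι} (hi : i ∈ S)
    (N : ℕ) (Ψ : (ι → ℕ) → ℝ) :
    ∑ x ∈ S.piAntidiag (N + 1), weight r x * r i (x i) * Ψ x
      = ∑ w ∈ S.piAntidiag N, weight r w * Ψ (w + Pi.single i 1) := by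
  have hsub : (S.piAntidiag N).map (addRightEmbedding (Pi.single i 1)) ⊆ S.piAntidiag (N + 1) := by
    intro x hx
    obtain ⟨w, hw, rfl⟩ := Finset.mem_map.1 hx
    exact add_single_mem hw hi 1
  rw [← Finset.sum_subset hsub, Finset.sum_map]
  · refine Finset.sum_congr rfl fun w _ => ?_
    rw [addRightEmbedding_apply, ← h.weight_add_single_one w i]
    simp
  · intro x hx hx'
    have h0 : x i = 0 := by
      by_contra hne
      obtain ⟨w, hw, rfl⟩ := exists_eq_add_single hx hne
      exact hx' (Finset.mem_map.2 ⟨w, hw, rfl⟩)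
    rw [h0, h.zero i]; ring

theorem sum_weight_mul_eq_sum_erase (r : ι → ℕ → ℝ) {S : Finset ι} {i : ι} (hi : i ∈ S) (N : ℕ)
    (Ψ : (ι → ℕ) → ℝ) :
    ∑ x ∈ S.piAntidiag N, weight r x * Ψ x
      = ∑ k ∈ Finset.range (N + 1), siteWeight (r i) k *
          ∑ y ∈ (S.erase i).piAntidiag (N - k), weight r y * Ψ (y + Pi.single i k) := by
  rw [sum_piAntidiag_eq_sum_erase hi]
  refine Finset.sum_congr rfl fun k _ => ?_
  rw [Finset.mul_sum]
  refine Finset.sum_congr rfl fun y hy => ?_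
  rw [weight_add_single_of_eq_zero r (eq_zero_of_mem_erase hy)]
  ring

theorem RateBounds.partitionFn_pos (h : RateBounds r δ Δ) {S : Finset ι} (hS : S.Nonempty)
    (N : ℕ) : 0 < partitionFn r S N :=
  Finset.sum_pos (fun x _ => h.weight_pos x) (piAntidiag_nonempty hS N)

theorem RateBounds.sum_weight_mul_rate_eq_partitionFn (h : RateBounds r δ Δ) {S : Finset ι} {i : ι}
    (hi : i ∈ S) (N : ℕ) :
    ∑ x ∈ S.piAntidiag (N + 1), weight r x * r i (x i) = partitionFn r S N := by
  simpa [partitionFn] using h.sum_weight_mul_rate hi N fun _ => 1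

/-- The total exit rate lies between `δ` and `Δ` times the number of particles, on average. -/
theorem RateBounds.partitionFn_bounds (h : RateBounds r δ Δ) (S : Finset ι) (N : ℕ) :
    δ * (N + 1) * partitionFn r S (N + 1) ≤ S.card * partitionFn r S N ∧
      S.card * partitionFn r S N ≤ Δ * (N + 1) * partitionFn r S (N + 1) := by
  have h1 : S.card * partitionFn r S N
      = ∑ x ∈ S.piAntidiag (N + 1), weight r x * ∑ i ∈ S, r i (x i) := by
    simp only [Finset.mul_sum]
    rw [Finset.sum_comm, Finset.sum_congr rfl fun i hi =>
      h.sum_weight_mul_rate_eq_partitionFn hi N]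
    simp
  have hcard : ∀ x ∈ S.piAntidiag (N + 1), ((N : ℝ) + 1) = ∑ i ∈ S, (x i : ℝ) := by
    intro x hx
    have := (Finset.mem_piAntidiag.1 hx).1
    exact_mod_cast this.symm
  rw [h1, partitionFn, Finset.mul_sum, Finset.mul_sum]
  constructor
  · refine Finset.sum_le_sum fun x hx => ?_
    rw [mul_comm]
    refine mul_le_mul_of_nonneg_left ?_ (h.weight_pos x).le
    rw [hcard x hx, Finset.mul_sum]
    exact Finset.sum_le_sum fun i _ => h.mul_le i (x i)
  · refine Finset.sum_le_sum fun x hx => ?_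
    rw [mul_comm (Δ * _)]
    refine mul_le_mul_of_nonneg_left ?_ (h.weight_pos x).le
    rw [hcard x hx, Finset.mul_sum]
    exact Finset.sum_le_sum fun i _ => h.le_mul i (x i)

end MeanField

/-! ### Stationary measures of the mean-field zero-range process -/

namespace MeanField

/-- A finite collection of moves `T e`, performed at rates `c e`, has a stationary probability
vector. The rate matrix is singular; a left null vector exists, and so its absolute value, which is
null as well because the off-diagonal rates are nonnegative and the rows sum to zero. -/
theorem exists_stationary {α β : Type*} {Ω : Finset α} (hΩ : Ω.Nonempty)
    (E : Finset β) (c : β → α → ℝ) (T : β → α → α) (hc : ∀ e ∈ E, ∀ x ∈ Ω, 0 ≤ c e x)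
    (hT : ∀ e ∈ E, ∀ x ∈ Ω, c e x ≠ 0 → T e x ∈ Ω) :
    ∃ ν : α → ℝ, (∀ x ∈ Ω, 0 ≤ ν x) ∧ ∑ x ∈ Ω, ν x = 1 ∧
      ∀ F : α → ℝ, ∑ x ∈ Ω, ν x * ∑ e ∈ E, c e x * (F (T e x) - F x) = 0 := by
  classical
  let L : Matrix Ω Ω ℝ := fun x y =>
    ∑ e ∈ E, c e x * ((if T e x = y then 1 else 0) - if (x : α) = y then 1 else 0)
  have hL : ∀ (F : α → ℝ) (x : Ω),
      ∑ y : Ω, L x y * F y = ∑ e ∈ E, c e x * (F (T e x) - F x) := by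
    intro F x
    simp only [L, Finset.sum_mul]
    rw [Finset.sum_comm]
    refine Finset.sum_congr rfl fun e he => ?_
    rcases eq_or_ne (c e x) 0 with h0 | h0
    · simp [h0]
    · have hTx := hT e he x x.2 h0
      simp only [mul_assoc]
      rw [← Finset.mul_sum]
      congr 1
      simp only [sub_mul, Finset.sum_sub_distrib]
      rw [Finset.sum_coe_sort Ω fun y => (if T e x = y then 1 else 0) * F y,
        Finset.sum_coe_sort Ω fun y => (if (x : α) = y then 1 else 0) * F y]
      simp [hTx]
  have hrow : ∀ x, ∑ y, L x y = 0 := fun x => by simpa using hL (fun _ => 1) x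
  have hoff : ∀ x y, x ≠ y → 0 ≤ L x y := by
    intro x y hxy
    refine Finset.sum_nonneg fun e he => mul_nonneg (hc e he x x.2) ?_
    have : (x : α) ≠ y := fun h => hxy (Subtype.ext h)
    rw [if_neg this, sub_zero]
    split_ifs <;> norm_num
  have : Nonempty Ω := hΩ.coe_sort
  have hdet : L.det = 0 := by
    refine Matrix.exists_mulVec_eq_zero_iff.1 ⟨fun _ => 1, ?_, ?_⟩
    · exact fun h => one_ne_zero (congrFun h (Classical.arbitrary Ω))
    · funext x
      simpa [Matrix.mulVec, dotProduct] using hrow x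
  obtain ⟨v, hv0, hv⟩ := Matrix.exists_vecMul_eq_zero_iff.2 hdet
  have hv' : ∀ y, ∑ x, v x * L x y = 0 := fun y => congrFun hv y
  have hdiag : ∀ y, L y y ≤ 0 := by
    intro y
    have h1 := hrow y
    rw [← Finset.add_sum_erase _ _ (Finset.mem_univ y)] at h1
    have h2 : 0 ≤ ∑ x ∈ Finset.univ.erase y, L y x :=
      Finset.sum_nonneg fun x hx => hoff y x (Finset.ne_of_mem_erase hx).symm
    linarith
  have hge : ∀ y ∈ Finset.univ, 0 ≤ ∑ x, |v x| * L x y := by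
    intro y _
    have h1 := hv' y
    rw [← Finset.add_sum_erase _ _ (Finset.mem_univ y)] at h1 ⊢
    have h2 : |v y| * -L y y ≤ ∑ x ∈ Finset.univ.erase y, |v x| * L x y := by
      calc |v y| * -L y y = |∑ x ∈ Finset.univ.erase y, v x * L x y| := by
            rw [← abs_of_nonneg (neg_nonneg.2 (hdiag y)), ← abs_mul]
            congr 1
            linarith
        _ ≤ ∑ x ∈ Finset.univ.erase y, |v x * L x y| := Finset.abs_sum_le_sum_abs _ _
        _ = _ := Finset.sum_congr rfl fun x hx => by
            rw [abs_mul, abs_of_nonneg (hoff x y (Finset.ne_of_mem_erase hx))]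
    linarith
  have habs : ∀ y, ∑ x, |v x| * L x y = 0 := by
    have htot : ∑ y, ∑ x, |v x| * L x y = 0 := by
      rw [Finset.sum_comm]
      refine Finset.sum_eq_zero fun x _ => ?_
      rw [← Finset.mul_sum, hrow x, mul_zero]
    exact fun y => (Finset.sum_eq_zero_iff_of_nonneg hge).1 htot y (Finset.mem_univ y)
  have hmass : 0 < ∑ x, |v x| := by
    obtain ⟨x, hx⟩ := Function.ne_iff.1 hv0
    exact Finset.sum_pos' (fun _ _ => abs_nonneg _) ⟨x, Finset.mem_univ x, abs_pos.2 hx⟩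
  set ν : α → ℝ := fun x => if hx : x ∈ Ω then |v ⟨x, hx⟩| / ∑ x, |v x| else 0 with hνdef
  have hν : ∀ x : Ω, ν x = |v x| / ∑ x, |v x| := fun x => by simp [hνdef]
  refine ⟨ν, fun x hx => ?_, ?_, fun F => ?_⟩
  · rw [hν ⟨x, hx⟩]
    positivity
  · rw [← Finset.sum_coe_sort Ω ν, Finset.sum_congr rfl fun x _ => hν x, ← Finset.sum_div,
      div_self hmass.ne']
  · rw [← Finset.sum_coe_sort Ω fun x => ν x * ∑ e ∈ E, c e x * (F (T e x) - F x)]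
    simp only [← hL F, Finset.mul_sum]
    rw [Finset.sum_comm]
    refine Finset.sum_eq_zero fun y _ => ?_
    have h1 : ∑ x : Ω, ν x * (L x y * F y) = (∑ x, |v x| * L x y) * (F y / ∑ x, |v x|) := by
      rw [Finset.sum_mul]
      refine Finset.sum_congr rfl fun x _ => ?_
      rw [hν x]; ring
    rw [h1, habs y, zero_mul]

variable {ι : Type*} [DecidableEq ι]

/-- The generator of the zero-range process on the complete graph with vertex set `S`: particles
leave `i` at rate `r i` for each of the sites of `S`. -/
def zrpGen (r : ι → ℕ → ℝ) (S : Finset ι) (f : (ι → ℕ) → ℝ) (x : ι → ℕ) : ℝ :=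
  ∑ i ∈ S, r i (x i) * ∑ k ∈ S, (f (x - Pi.single i 1 + Pi.single k 1) - f x)

/-- Configurations with a positive number of particles are connected by moves of single
particles. -/
theorem eq_of_forall_move_eq {S : Finset ι} {N : ℕ} {u : (ι → ℕ) → ℝ}
    (hu : ∀ w ∈ S.piAntidiag N, ∀ i ∈ S, ∀ k ∈ S, u (w + Pi.single i 1) = u (w + Pi.single k 1)) :
    ∀ x ∈ S.piAntidiag (N + 1), ∀ y ∈ S.piAntidiag (N + 1), u x = u y := by
  rcases S.eq_empty_or_nonempty with rfl | ⟨i₀, hi₀⟩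
  · intro x hx
    simp at hx
  -- gather all the particles at `i₀`, one at a time
  suffices hmain : ∀ t : ℕ, ∀ x ∈ S.piAntidiag (N + 1), x i₀ + t = N + 1 →
      u x = u (Pi.single i₀ (N + 1)) by
    have hle : ∀ x ∈ S.piAntidiag (N + 1), x i₀ ≤ N + 1 := fun x hx => by
      rw [← (Finset.mem_piAntidiag.1 hx).1]
      exact Finset.single_le_sum (f := x) (fun _ _ => Nat.zero_le _) hi₀
    intro x hx y hy
    rw [hmain _ x hx (Nat.add_sub_cancel' (hle x hx)),
      hmain _ y hy (Nat.add_sub_cancel' (hle y hy))]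
  intro t
  induction t with
  | zero =>
    intro x hx hx0
    congr 1
    rw [Finset.mem_piAntidiag] at hx
    have hsum : x i₀ + ∑ j ∈ S.erase i₀, x j = N + 1 := by
      rw [Finset.add_sum_erase _ _ hi₀]; exact hx.1
    have hz : ∑ j ∈ S.erase i₀, x j = 0 := by omega
    funext j
    by_cases hj : j = i₀
    · subst hj; simpa using hx0
    · rw [Pi.single_eq_of_ne hj]
      by_contra hne
      exact hne (Finset.sum_eq_zero_iff.1 hz j (Finset.mem_erase.2 ⟨hj, hx.2 j hne⟩))
  | succ t ih =>
    intro x hx hxt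
    obtain ⟨j, hj, hxj⟩ : ∃ j ∈ S.erase i₀, x j ≠ 0 := by
      by_contra! hall
      have hsum : x i₀ + ∑ j ∈ S.erase i₀, x j = N + 1 := by
        rw [Finset.add_sum_erase _ _ hi₀]; exact (Finset.mem_piAntidiag.1 hx).1
      rw [Finset.sum_eq_zero hall] at hsum
      omega
    obtain ⟨w, hw, rfl⟩ := exists_eq_add_single hx hxj
    rw [hu w hw j (Finset.mem_of_mem_erase hj) i₀ hi₀]
    refine ih _ (add_single_mem hw hi₀ 1) ?_
    have hne : i₀ ≠ j := (Finset.ne_of_mem_erase hj).symm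
    simp [hne] at hxt ⊢
    omega

theorem RateBounds.zrpGen_zero {r : ι → ℕ → ℝ} {δ Δ : ℝ} (h : RateBounds r δ Δ) (S : Finset ι)
    (f : (ι → ℕ) → ℝ) : zrpGen r S f 0 = 0 := by
  simp [zrpGen, h.zero]

theorem RateBounds.move_mem {r : ι → ℕ → ℝ} {δ Δ : ℝ} (h : RateBounds r δ Δ) {S : Finset ι} {N : ℕ}
    {x : ι → ℕ} (hx : x ∈ S.piAntidiag N) {i k : ι} (hk : k ∈ S) (hr : r i (x i) ≠ 0) :
    x - Pi.single i 1 + Pi.single k 1 ∈ S.piAntidiag N := by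
  have hxi : x i ≠ 0 := fun h0 => hr (by rw [h0, h.zero i])
  cases N with
  | zero =>
    rw [Finset.piAntidiag_zero, Finset.mem_singleton] at hx
    simp [hx] at hxi
  | succ N =>
    obtain ⟨w, hw, rfl⟩ := exists_eq_add_single hx hxi
    rw [add_tsub_cancel_right]
    exact add_single_mem hw hk 1

variable [Fintype ι] {r : ι → ℕ → ℝ} {δ Δ : ℝ} {S : Finset ι}

namespace RateBounds

theorem sum_weight_mul_zrpGen (h : RateBounds r δ Δ) (N : ℕ) (g f : (ι → ℕ) → ℝ) :
    ∑ x ∈ S.piAntidiag (N + 1), weight r x * (g x * zrpGen r S f x)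
      = -(1 / 2) * ∑ w ∈ S.piAntidiag N, weight r w * ∑ i ∈ S, ∑ k ∈ S,
          (g (w + Pi.single k 1) - g (w + Pi.single i 1))
            * (f (w + Pi.single k 1) - f (w + Pi.single i 1)) := by
  have h1 : ∑ x ∈ S.piAntidiag (N + 1), weight r x * (g x * zrpGen r S f x)
      = ∑ w ∈ S.piAntidiag N, weight r w * ∑ i ∈ S, ∑ k ∈ S,
          g (w + Pi.single i 1) * (f (w + Pi.single k 1) - f (w + Pi.single i 1)) := by
    simp only [zrpGen, Finset.mul_sum]
    rw [Finset.sum_comm]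
    conv_rhs => rw [Finset.sum_comm]
    refine Finset.sum_congr rfl fun i hi => ?_
    simp only [← Finset.mul_sum]
    have := h.sum_weight_mul_rate hi N fun x =>
      g x * ∑ k ∈ S, (f (x - Pi.single i 1 + Pi.single k 1) - f x)
    simp only [add_tsub_cancel_right] at this
    rw [← this]
    exact Finset.sum_congr rfl fun x _ => by ring
  rw [h1, Finset.mul_sum]
  refine Finset.sum_congr rfl fun w _ => ?_
  set G := fun i => g (w + Pi.single i 1)
  set F := fun i => f (w + Pi.single i 1)
  have hswap : ∑ i ∈ S, ∑ k ∈ S, G i * (F k - F i) = ∑ i ∈ S, ∑ k ∈ S, G k * (F i - F k) :=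
    Finset.sum_comm
  have h2 : ∑ i ∈ S, ∑ k ∈ S, (G k - G i) * (F k - F i)
      = -∑ i ∈ S, ∑ k ∈ S, G k * (F i - F k) - ∑ i ∈ S, ∑ k ∈ S, G i * (F k - F i) := by
    simp only [← Finset.sum_neg_distrib, ← Finset.sum_sub_distrib]
    exact Finset.sum_congr rfl fun i _ => Finset.sum_congr rfl fun k _ => by ring
  change weight r w * ∑ i ∈ S, ∑ k ∈ S, G i * (F k - F i)
    = -(1 / 2) * (weight r w * ∑ i ∈ S, ∑ k ∈ S, (G k - G i) * (F k - F i))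
  rw [h2, ← hswap]
  ring

theorem sum_weight_mul_zrpGen_comm (h : RateBounds r δ Δ) (N : ℕ) (g f : (ι → ℕ) → ℝ) :
    ∑ x ∈ S.piAntidiag N, weight r x * (g x * zrpGen r S f x)
      = ∑ x ∈ S.piAntidiag N, weight r x * (f x * zrpGen r S g x) := by
  cases N with
  | zero => simp [h.zrpGen_zero]
  | succ N =>
    simp only [h.sum_weight_mul_zrpGen, mul_comm (g _ - g _)]

/-- The weight is, up to a constant, the only stationary measure. -/
theorem stationary_eq (h : RateBounds r δ Δ) (hS : S.Nonempty) {N : ℕ} {ν : (ι → ℕ) → ℝ}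
    (hν : ∀ φ : (ι → ℕ) → ℝ, ∑ x ∈ S.piAntidiag N, ν x * zrpGen r S φ x = 0)
    (hone : ∑ x ∈ S.piAntidiag N, ν x = 1) {x : ι → ℕ} (hx : x ∈ S.piAntidiag N) :
    ν x = weight r x / partitionFn r S N := by
  set u : (ι → ℕ) → ℝ := fun x => ν x / weight r x with hu
  have hνu : ∀ x, ν x = weight r x * u x := fun x => by
    rw [hu]; field_simp [(h.weight_pos x).ne']
  have hconst : ∀ y ∈ S.piAntidiag N, u y = u x := by
    cases N with
    | zero =>
      intro y hy
      rw [Finset.piAntidiag_zero, Finset.mem_singleton] at hx hy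
      rw [hx, hy]
    | succ N =>
      have h0 := hν u
      simp only [hνu, mul_assoc] at h0
      rw [h.sum_weight_mul_zrpGen] at h0
      have h1 : ∑ w ∈ S.piAntidiag N, weight r w * ∑ i ∈ S, ∑ k ∈ S,
          (u (w + Pi.single k 1) - u (w + Pi.single i 1))
            * (u (w + Pi.single k 1) - u (w + Pi.single i 1)) = 0 := by linarith
      refine fun y hy => eq_of_forall_move_eq (fun w hw i hi k hk => ?_) y hy x hx
      have h2 := (Finset.sum_eq_zero_iff_of_nonneg fun w _ => mul_nonneg (h.weight_pos w).le
        (Finset.sum_nonneg fun i _ => Finset.sum_nonneg fun k _ => mul_self_nonneg _)).1 h1 w hw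
      have h3 := (mul_eq_zero.1 h2).resolve_left (h.weight_pos w).ne'
      have h4 := (Finset.sum_eq_zero_iff_of_nonneg fun i _ =>
        Finset.sum_nonneg fun k _ => mul_self_nonneg _).1 h3 i hi
      have h5 := (Finset.sum_eq_zero_iff_of_nonneg fun k _ => mul_self_nonneg _).1 h4 k hk
      linarith [mul_self_eq_zero.1 h5]
  have hZ := h.partitionFn_pos hS N
  have h6 : partitionFn r S N * u x = 1 := by
    rw [← hone, partitionFn, Finset.sum_mul]
    exact Finset.sum_congr rfl fun y hy => by rw [hνu y, hconst y hy]
  rw [hνu x, eq_div_iff hZ.ne', mul_assoc, mul_comm (u x), h6, mul_one]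

end RateBounds

end MeanField

/-! ### The second-class particle -/

namespace MeanField

variable {ι : Type*} [DecidableEq ι] {r : ι → ℕ → ℝ} {δ Δ : ℝ} {S : Finset ι}

namespace RateBounds

/-- A configuration `z` together with a second-class particle `j`: the particles of `z` ignore the
second-class one, which leaves `j` at the excess rate `r j (z j + 1) - r j (z j)`. This joint
process has a stationary law. -/
theorem exists_stationary_secondClass (h : RateBounds r δ Δ) (hS : S.Nonempty) (N : ℕ) :
    ∃ ν : (ι → ℕ) → ι → ℝ, (∀ z ∈ S.piAntidiag N, ∀ j ∈ S, 0 ≤ ν z j) ∧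
      ∑ z ∈ S.piAntidiag N, ∑ j ∈ S, ν z j = 1 ∧
      ∀ F : (ι → ℕ) → ι → ℝ, ∑ z ∈ S.piAntidiag N, ∑ j ∈ S,
        ν z j * (zrpGen r S (fun y => F y j) z
          + (r j (z j + 1) - r j (z j)) * ∑ k ∈ S, (F z k - F z j)) = 0 := by
  obtain ⟨ν, hν0, hν1, hν⟩ := exists_stationary (Ω := S.piAntidiag N ×ˢ S)
    ((piAntidiag_nonempty hS N).product hS) ((S ×ˢ S).disjSum S)
    (Sum.elim (fun e x => r e.1 (x.1 e.1)) fun _ x => r x.2 (x.1 x.2 + 1) - r x.2 (x.1 x.2))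
    (Sum.elim (fun e x => (x.1 - Pi.single e.1 1 + Pi.single e.2 1, x.2)) fun k x => (x.1, k))
    (by
      rintro (e | k) _ x _
      · exact h.nonneg _ _
      · have := (h.incr x.2 (x.1 x.2)).1
        change 0 ≤ r x.2 (x.1 x.2 + 1) - r x.2 (x.1 x.2)
        linarith [h.pos])
    (by
      rintro (e | k) he x hx hne
      · rw [Finset.inl_mem_disjSum, Finset.mem_product] at he
        rw [Finset.mem_product] at hx
        exact Finset.mem_product.2 ⟨h.move_mem hx.1 he.2 hne, hx.2⟩
      · rw [Finset.inr_mem_disjSum] at he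
        rw [Finset.mem_product] at hx
        exact Finset.mem_product.2 ⟨hx.1, he⟩)
  refine ⟨fun z j => ν (z, j), fun z hz j hj => hν0 _ (Finset.mem_product.2 ⟨hz, hj⟩), ?_,
    fun F => ?_⟩
  · rw [← hν1, Finset.sum_product]
  · have h1 := hν fun x => F x.1 x.2
    rw [Finset.sum_product] at h1
    rw [← h1]
    refine Finset.sum_congr rfl fun z _ => Finset.sum_congr rfl fun j _ => ?_
    rw [Finset.sum_disjSum, Finset.sum_product]
    simp only [Sum.elim_inl, Sum.elim_inr, zrpGen, Finset.mul_sum]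

/-- Adding the second-class particle to `z` turns the joint process into a zero-range process with
one more particle. -/
theorem zrpGen_add_single (h : RateBounds r δ Δ) (φ : (ι → ℕ) → ℝ) (z : ι → ℕ) {j : ι}
    (hj : j ∈ S) :
    zrpGen r S (fun y => φ (y + Pi.single j 1)) z
        + (r j (z j + 1) - r j (z j)) * ∑ k ∈ S, (φ (z + Pi.single k 1) - φ (z + Pi.single j 1))
      = zrpGen r S φ (z + Pi.single j 1) := by
  have hite : (r j (z j + 1) - r j (z j))
        * ∑ k ∈ S, (φ (z + Pi.single k 1) - φ (z + Pi.single j 1))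
      = ∑ i ∈ S, if i = j then (r j (z j + 1) - r j (z j))
        * ∑ k ∈ S, (φ (z + Pi.single k 1) - φ (z + Pi.single j 1)) else 0 := by
    rw [Finset.sum_ite_eq' S j, if_pos hj]
  rw [hite]
  unfold zrpGen
  rw [← Finset.sum_add_distrib]
  refine Finset.sum_congr rfl fun i _ => ?_
  rcases eq_or_ne (z i) 0 with h0 | h0
  · rw [h0, h.zero, zero_mul, zero_add]
    by_cases hij : i = j
    · subst hij
      simp [h0, h.zero]
    · have h1 : (z + Pi.single j 1 : ι → ℕ) i = 0 := by simp [h0, hij]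
      rw [h1, h.zero, zero_mul, if_neg hij]
  · have hle : (Pi.single i 1 : ι → ℕ) ≤ z := by
      intro l
      by_cases hl : l = i
      · subst hl; simp; omega
      · simp [hl]
    obtain ⟨w, rfl⟩ : ∃ w, z = w + Pi.single i 1 := ⟨z - Pi.single i 1, by
      rw [tsub_add_cancel_of_le hle]⟩
    have h1 : ∀ k, w + Pi.single i 1 + Pi.single j 1 - Pi.single i 1 + Pi.single k 1
        = w + Pi.single i 1 - Pi.single i 1 + Pi.single k 1 + (Pi.single j 1 : ι → ℕ) := by
      intro k
      rw [add_right_comm w, add_tsub_cancel_right, add_tsub_cancel_right, add_right_comm]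
    simp only [h1]
    by_cases hij : i = j
    · subst hij
      have h2 : (w + Pi.single i 1 + Pi.single i 1 : ι → ℕ) i
          = (w + Pi.single i 1 : ι → ℕ) i + 1 := by simp
      have h3 : ∀ k, w + Pi.single i 1 - Pi.single i 1 + Pi.single k 1 + (Pi.single i 1 : ι → ℕ)
          = w + Pi.single i 1 + Pi.single k 1 := by
        intro k
        rw [add_tsub_cancel_right, add_right_comm]
      rw [if_pos rfl, h2]
      simp only [h3]
      ring
    · have h2 : (w + Pi.single i 1 + Pi.single j 1 : ι → ℕ) i
          = (w + Pi.single i 1 : ι → ℕ) i := by simp [hij]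
      rw [if_neg hij, h2, add_zero]

variable [Fintype ι]

/-- The systems with `N` and `N + 1` particles can be coupled so that they differ by one particle,
and given the smaller system the extra particle is spread over `S` almost uniformly: no site is
chosen with probability more than `Δ / δ` times the uniform one. This is the stationary law of the
second-class particle, and the bound is a maximum principle for its density. -/
theorem exists_coupling (h : RateBounds r δ Δ) (hS : S.Nonempty) (N : ℕ) :
    ∃ q : (ι → ℕ) → ι → ℝ,
      (∀ z ∈ S.piAntidiag N, ∀ j ∈ S, 0 ≤ q z j ∧ q z j ≤ Δ / (δ * S.card)) ∧
      (∀ z ∈ S.piAntidiag N, ∑ j ∈ S, q z j = 1) ∧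
      ∀ f : (ι → ℕ) → ℝ,
        (∑ z ∈ S.piAntidiag N, weight r z * ∑ j ∈ S, q z j * f (z + Pi.single j 1))
            / partitionFn r S N
          = (∑ x ∈ S.piAntidiag (N + 1), weight r x * f x) / partitionFn r S (N + 1) := by
  obtain ⟨ν, hν0, hν1, hν⟩ := h.exists_stationary_secondClass hS N
  have hZ := h.partitionFn_pos hS N
  -- the law of the smaller system
  have hmarg : ∀ z ∈ S.piAntidiag N, ∑ j ∈ S, ν z j = weight r z / partitionFn r S N := by
    intro z hz
    refine h.stationary_eq hS (ν := fun z => ∑ j ∈ S, ν z j) (fun φ => ?_) hν1 hz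
    rw [← hν fun y _ => φ y]
    refine Finset.sum_congr rfl fun z _ => ?_
    rw [Finset.sum_mul]
    refine Finset.sum_congr rfl fun j _ => ?_
    simp
  -- the law of the larger system
  have hmarg' : ∀ f : (ι → ℕ) → ℝ, ∑ z ∈ S.piAntidiag N, ∑ j ∈ S, ν z j * f (z + Pi.single j 1)
      = (∑ x ∈ S.piAntidiag (N + 1), weight r x * f x) / partitionFn r S (N + 1) := by
    set ν' : (ι → ℕ) → ℝ := fun x =>
      ∑ z ∈ S.piAntidiag N, ∑ j ∈ S, if z + Pi.single j 1 = x then ν z j else 0 with hν'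
    have hpush : ∀ f : (ι → ℕ) → ℝ, ∑ x ∈ S.piAntidiag (N + 1), ν' x * f x
        = ∑ z ∈ S.piAntidiag N, ∑ j ∈ S, ν z j * f (z + Pi.single j 1) := by
      intro f
      simp only [hν', Finset.sum_mul]
      rw [Finset.sum_comm]
      refine Finset.sum_congr rfl fun z hz => ?_
      rw [Finset.sum_comm]
      refine Finset.sum_congr rfl fun j hj => ?_
      simp only [ite_mul, zero_mul]
      rw [Finset.sum_ite_eq, if_pos (add_single_mem hz hj 1)]
    have hν'one : ∑ x ∈ S.piAntidiag (N + 1), ν' x = 1 := by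
      simpa [hν1] using hpush fun _ => 1
    have hst : ∀ φ : (ι → ℕ) → ℝ, ∑ x ∈ S.piAntidiag (N + 1), ν' x * zrpGen r S φ x = 0 := by
      intro φ
      rw [hpush, ← hν fun y j => φ (y + Pi.single j 1)]
      refine Finset.sum_congr rfl fun z _ => Finset.sum_congr rfl fun j hj => ?_
      rw [h.zrpGen_add_single φ z hj]
    intro f
    rw [← hpush f, Finset.sum_div]
    refine Finset.sum_congr rfl fun x hx => ?_
    rw [h.stationary_eq hS hst hν'one hx]
    ring
  set q : (ι → ℕ) → ι → ℝ := fun z j => ν z j * partitionFn r S N / weight r z with hq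
  have hνq : ∀ z j, ν z j = weight r z * q z j / partitionFn r S N := by
    intro z j
    have := (h.weight_pos z).ne'
    rw [hq]; field_simp
  have hq0 : ∀ z ∈ S.piAntidiag N, ∀ j ∈ S, 0 ≤ q z j := fun z hz j hj =>
    div_nonneg (mul_nonneg (hν0 z hz j hj) hZ.le) (h.weight_pos z).le
  have hq1 : ∀ z ∈ S.piAntidiag N, ∑ j ∈ S, q z j = 1 := by
    intro z hz
    have h1 := hmarg z hz
    have h2 := (h.weight_pos z).ne'
    rw [hq]
    simp only
    rw [← Finset.sum_div, ← Finset.sum_mul, h1]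
    field_simp
  refine ⟨q, fun z hz j hj => ⟨hq0 z hz j hj, ?_⟩, hq1, fun f => ?_⟩
  · obtain ⟨⟨y, l⟩, hyl, hmax⟩ := Finset.exists_max_image (S.piAntidiag N ×ˢ S)
      (fun x => q x.1 x.2) ((piAntidiag_nonempty hS N).product hS)
    obtain ⟨hy, hl⟩ : y ∈ S.piAntidiag N ∧ l ∈ S := Finset.mem_product.1 hyl
    have hmax' : ∀ z ∈ S.piAntidiag N, ∀ j ∈ S, q z j ≤ q y l := fun z hz j hj =>
      hmax (z, j) (Finset.mem_product.2 ⟨hz, hj⟩)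
    refine (hmax' z hz j hj).trans ?_
    -- test stationarity against the indicator function of the maximum `(y, l)`
    have hgen : zrpGen r S (fun z => q z l) y ≤ 0 := by
      refine Finset.sum_nonpos fun i _ => ?_
      rcases eq_or_ne (r i (y i)) 0 with h0 | h0
      · simp [h0]
      · refine mul_nonpos_of_nonneg_of_nonpos (h.nonneg _ _)
          (Finset.sum_nonpos fun k hk => ?_)
        have := hmax' _ (h.move_mem hy hk h0) l hl
        linarith
    have htest := hν fun z j => if z = y ∧ j = l then 1 else 0
    simp only [mul_add, Finset.sum_add_distrib] at htest
    have hA : ∑ z ∈ S.piAntidiag N, ∑ j ∈ S,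
        ν z j * zrpGen r S (fun z => if z = y ∧ j = l then 1 else 0) z
        = weight r y * zrpGen r S (fun z => q z l) y / partitionFn r S N := by
      have h1 : ∀ z, ∑ j ∈ S, ν z j * zrpGen r S (fun z => if z = y ∧ j = l then 1 else 0) z
          = weight r z * (q z l * zrpGen r S (fun z => if z = y then 1 else 0) z)
            / partitionFn r S N := by
        intro z
        rw [Finset.sum_eq_single l]
        · simp only [and_true]
          rw [hνq]; ring
        · intro j _ hjl
          simp [hjl, zrpGen]
        · exact fun hn => absurd hl hn
      simp only [h1]
      rw [← Finset.sum_div, h.sum_weight_mul_zrpGen_comm]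
      congr 1
      rw [Finset.sum_eq_single y]
      · simp
      · intro z _ hzy
        simp [hzy]
      · exact fun hn => absurd hy hn
    have hB : ∑ z ∈ S.piAntidiag N, ∑ j ∈ S, ν z j * ((r j (z j + 1) - r j (z j))
          * ∑ k ∈ S, ((if z = y ∧ k = l then 1 else 0) - if z = y ∧ j = l then 1 else 0))
        = (weight r y * ∑ j ∈ S, q y j * (r j (y j + 1) - r j (y j))
          - weight r y * S.card * (q y l * (r l (y l + 1) - r l (y l)))) / partitionFn r S N := by
      rw [Finset.sum_eq_single y]
      · have h1 : ∀ j, ∑ k ∈ S, ((if k = l then (1 : ℝ) else 0)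
            - if j = l then 1 else 0) = 1 - if j = l then (S.card : ℝ) else 0 := by
          intro j
          simp only [Finset.sum_sub_distrib, Finset.sum_ite_eq', hl, if_true,
            Finset.sum_const, nsmul_eq_mul]
          split_ifs <;> simp
        have h2 : ∀ j, ν y j * ((r j (y j + 1) - r j (y j))
              * (1 - if j = l then (S.card : ℝ) else 0))
            = weight r y * (q y j * (r j (y j + 1) - r j (y j))) / partitionFn r S N
              - if j = l then weight r y * S.card * (q y j * (r j (y j + 1) - r j (y j)))
                / partitionFn r S N else 0 := by
          intro j
          rw [hνq]
          split_ifs <;> ring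
        simp only [true_and, h1, h2]
        rw [Finset.sum_sub_distrib, Finset.sum_ite_eq', if_pos hl, ← Finset.sum_div,
          ← Finset.mul_sum, sub_div]
      · intro z _ hzy
        simp [hzy]
      · exact fun hn => absurd hy hn
    rw [hA, hB, ← add_div, div_eq_zero_iff, or_iff_left hZ.ne'] at htest
    have hwy := h.weight_pos y
    have hsum : ∑ j ∈ S, q y j * (r j (y j + 1) - r j (y j)) ≤ Δ := by
      calc _ ≤ ∑ j ∈ S, q y j * Δ := Finset.sum_le_sum fun j hj =>
            mul_le_mul_of_nonneg_left (h.incr j (y j)).2 (hq0 y hy j hj)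
        _ = Δ := by rw [← Finset.sum_mul, hq1 y hy, one_mul]
    have hbal : S.card * (q y l * (r l (y l + 1) - r l (y l))) ≤ Δ := by
      have h1 : weight r y * (zrpGen r S (fun z => q z l) y
          + ∑ j ∈ S, q y j * (r j (y j + 1) - r j (y j))
          - S.card * (q y l * (r l (y l + 1) - r l (y l)))) = 0 := by linarith
      have h2 := (mul_eq_zero.1 h1).resolve_left hwy.ne'
      linarith
    have hcard : (0 : ℝ) < S.card := by exact_mod_cast hS.card_pos
    rw [le_div_iff₀ (mul_pos h.pos hcard)]
    have h3 := mul_le_mul_of_nonneg_left (h.incr l (y l)).1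
      (mul_nonneg hcard.le (hq0 y hy l hl))
    linarith
  · rw [← hmarg' f, Finset.sum_div]
    refine Finset.sum_congr rfl fun z _ => ?_
    rw [Finset.mul_sum, Finset.sum_div]
    refine Finset.sum_congr rfl fun j _ => ?_
    rw [hνq]; ring

/-- The mean exit rate from a site does not decrease with the number of particles. -/
theorem partitionFn_ratio_mono (h : RateBounds r δ Δ) (hS : S.Nonempty) (N : ℕ) :
    partitionFn r S N / partitionFn r S (N + 1)
      ≤ partitionFn r S (N + 1) / partitionFn r S (N + 2) := by
  obtain ⟨i, hi⟩ := hS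
  have hS : S.Nonempty := ⟨i, hi⟩
  obtain ⟨q, hq0, hq1, hq⟩ := h.exists_coupling hS (N + 1)
  have h1 := hq fun x => r i (x i)
  rw [h.sum_weight_mul_rate_eq_partitionFn hi (N + 1)] at h1
  rw [← h1, ← h.sum_weight_mul_rate_eq_partitionFn hi N]
  refine div_le_div_of_nonneg_right (Finset.sum_le_sum fun z hz => ?_)
    (h.partitionFn_pos hS (N + 1)).le
  refine mul_le_mul_of_nonneg_left ?_ (h.weight_pos z).le
  calc r i (z i) = ∑ j ∈ S, q z j * r i (z i) := by rw [← Finset.sum_mul, hq1 z hz, one_mul]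
    _ ≤ _ := Finset.sum_le_sum fun j hj => mul_le_mul_of_nonneg_left ?_ (hq0 z hz j hj).1
  by_cases hji : j = i
  · subst hji
    have := (h.incr j (z j)).1
    simp only [Pi.add_apply, Pi.single_eq_same]
    linarith [h.pos]
  · simp [Ne.symm hji]

end RateBounds

end MeanField

/-! ### The mean-field logarithmic Sobolev inequality -/

namespace MeanField

variable {ι : Type*} [DecidableEq ι] {S : Finset ι}

/-- The part of the edge energy seen from `i`: the edges avoiding `i`, together with half of those
at `i`. -/
theorem sum_erase_add_sum_erase (D : ι → ι → ℝ) (hD : ∀ j, D j j = 0)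
    (hcomm : ∀ j l, D j l = D l j) {i : ι} (hi : i ∈ S) :
    ∑ j ∈ S.erase i, ∑ l ∈ S.erase i, D j l + ∑ j ∈ S.erase i, D i j
      = ∑ j ∈ S, ∑ l ∈ S, D j l - ∑ j ∈ S, D i j := by
  have h1 : ∀ j, ∑ l ∈ S, D j l = D j i + ∑ l ∈ S.erase i, D j l := fun j =>
    (Finset.add_sum_erase S (D j) hi).symm
  have h2 : ∑ j ∈ S, ∑ l ∈ S, D j l = ∑ l ∈ S, D i l + ∑ j ∈ S.erase i, ∑ l ∈ S, D j l :=
    (Finset.add_sum_erase S (fun j => ∑ l ∈ S, D j l) hi).symm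
  rw [h2]
  simp only [h1, Finset.sum_add_distrib, hD, hcomm _ i]
  ring

variable [Fintype ι] {r : ι → ℕ → ℝ} {δ Δ : ℝ}

/-- The mass, under the product weight, of the configurations with `k` particles at `i` and `N - k`
particles on the sites of `S`. -/
noncomputable def occWeight (r : ι → ℕ → ℝ) (S : Finset ι) (i : ι) (N k : ℕ) : ℝ :=
  siteWeight (r i) k * partitionFn r S (N - k)

/-- The mean of `f` given that there are `k` particles at `i` and `N - k` on the sites of `S`. -/
noncomputable def occMean (r : ι → ℕ → ℝ) (S : Finset ι) (i : ι) (N : ℕ) (f : (ι → ℕ) → ℝ)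
    (k : ℕ) : ℝ :=
  (∑ y ∈ S.piAntidiag (N - k), weight r y * f (y + Pi.single i k)) / partitionFn r S (N - k)

/-- The rate at which the number of particles at `i` increases from `k`, when the remaining `N - k`
particles are at equilibrium on the sites of `S`. -/
noncomputable def occBirth (r : ι → ℕ → ℝ) (S : Finset ι) (N k : ℕ) : ℝ :=
  if k < N then partitionFn r S (N - (k + 1)) / partitionFn r S (N - k) else 0

/-- The rate at which the number of particles at `i` decreases from `k`. -/
def occDeath (ρ : ℕ → ℝ) (N k : ℕ) : ℝ := if k ≤ N then ρ k else 0

/-- The sum over the edges of the mean-field process of the squared gradients of `√f`, for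
configurations of `N + 1` particles on `S`: configurations joined by an edge have `N` particles in
common. -/
noncomputable def edgeEnergy (r : ι → ℕ → ℝ) (S : Finset ι) (N : ℕ) (f : (ι → ℕ) → ℝ) : ℝ :=
  ∑ z ∈ S.piAntidiag N, weight r z *
    ∑ j ∈ S, ∑ l ∈ S, sqDist (f (z + Pi.single j 1)) (f (z + Pi.single l 1))

namespace RateBounds

theorem occBirth_bounds (h : RateBounds r δ Δ) (hS : S.Nonempty) {N k : ℕ} (hk : k < N) :
    δ / S.card ≤ occBirth r S N k ∧ occBirth r S N k ≤ Δ * (N - k) := by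
  obtain ⟨l, rfl⟩ : ∃ l, N = k + (l + 1) := ⟨N - k - 1, by omega⟩
  have h1 : k + (l + 1) - (k + 1) = l := by omega
  have h2 : k + (l + 1) - k = l + 1 := by omega
  have hZ := h.partitionFn_pos hS (l + 1)
  have hcard : (1 : ℝ) ≤ S.card := by exact_mod_cast hS.card_pos
  have hδ := h.pos
  obtain ⟨hlo, hhi⟩ := h.partitionFn_bounds S l
  obtain ⟨i, -⟩ := hS
  have hΔ : 0 ≤ Δ := hδ.le.trans (h.le i)
  rw [occBirth, if_pos hk, h1, h2]
  push_cast
  constructor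
  · rw [div_le_div_iff₀ (by linarith) hZ]
    have : δ * partitionFn r S (l + 1) ≤ δ * (l + 1) * partitionFn r S (l + 1) := by
      refine mul_le_mul_of_nonneg_right ?_ hZ.le
      exact le_mul_of_one_le_right hδ.le (by linarith [l.cast_nonneg (α := ℝ)])
    linarith
  · rw [div_le_iff₀ hZ]
    have h3 : partitionFn r S l ≤ S.card * partitionFn r S l := by
      refine le_mul_of_one_le_left ?_ hcard
      exact Finset.sum_nonneg fun x _ => (h.weight_pos x).le
    calc partitionFn r S l ≤ Δ * (l + 1) * partitionFn r S (l + 1) := h3.trans hhi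
      _ = _ := by ring

theorem occBirth_nonneg (h : RateBounds r δ Δ) (hS : S.Nonempty) (N k : ℕ) :
    0 ≤ occBirth r S N k := by
  unfold occBirth
  split_ifs
  · exact (div_pos (h.partitionFn_pos hS _) (h.partitionFn_pos hS _)).le
  · exact le_rfl

/-- At equilibrium the number of particles at `i` performs a birth–death chain, with death rates
`r i`, when averaged over the other sites. Its birth rates are nonincreasing because the mean exit
rate of the other sites increases with the number of their particles. -/
theorem birthDeath (h : RateBounds r δ Δ) (hS : S.Nonempty) (i : ι) {N m : ℕ} (hN : 1 ≤ N)
    (hm : N ≤ m) :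
    BirthDeath N (occWeight r S i N) (occBirth r S N) (occDeath (r i) N) δ (1 / (2 * Δ * m)) := by
  have hδ := h.pos
  have hΔ : 0 < Δ := hδ.trans_le (h.le i)
  have hNm : (N : ℝ) ≤ m := by exact_mod_cast hm
  have hN1 : (1 : ℝ) ≤ N := by exact_mod_cast hN
  have hden : 0 < 2 * Δ * m := by
    have : (0 : ℝ) < m := by linarith
    positivity
  have hΔN : Δ * N ≤ Δ * m := mul_le_mul_of_nonneg_left hNm hΔ.le
  have hb : ∀ k ≤ N, occBirth r S N k ≤ Δ * (N - k) := by
    intro k hk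
    rcases hk.lt_or_eq with hlt | rfl
    · exact (h.occBirth_bounds hS hlt).2
    · simp [occBirth]
  exact
    { weight_pos := fun k => mul_pos (h.siteWeight_pos i k) (h.partitionFn_pos hS _)
      birth_nonneg := h.occBirth_nonneg hS N
      death_nonneg := fun k => by
        unfold occDeath
        split_ifs
        · exact h.nonneg i k
        · exact le_rfl
      balance := fun k hk => by
        have hZ := (h.partitionFn_pos hS (N - k)).ne'
        have hr := (h.succ_pos i k).ne'
        have hsw : siteWeight (r i) (k + 1) = siteWeight (r i) k * (r i (k + 1))⁻¹ :=
          Finset.prod_range_succ _ _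
        rw [occWeight, occWeight, occBirth, occDeath, if_pos hk, if_pos (by omega), hsw]
        field_simp
      death_zero := by simp [occDeath, h.zero i]
      birth_top := by simp [occBirth]
      birth_anti := fun k hk => by
        by_cases hk1 : k + 1 < N
        · obtain ⟨l, rfl⟩ : ∃ l, N = k + (l + 2) := ⟨N - k - 2, by omega⟩
          have h1 : k + (l + 2) - (k + 1 + 1) = l := by omega
          have h2 : k + (l + 2) - (k + 1) = l + 1 := by omega
          have h3 : k + (l + 2) - k = l + 2 := by omega
          rw [occBirth, occBirth, if_pos hk1, if_pos hk, h1, h2, h3]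
          exact h.partitionFn_ratio_mono hS l
        · rw [occBirth, if_neg hk1]
          exact h.occBirth_nonneg hS N k
      death_incr := fun k hk => by
        rw [occDeath, occDeath, if_pos (show k + 1 ≤ N from hk), if_pos hk.le]
        exact (h.incr i k).1
      incr_pos := hδ
      step_pos := by positivity
      lazy := fun k => by
        rw [one_div, inv_mul_eq_div, div_le_iff₀ hden]
        by_cases hk : k ≤ N
        · rw [occDeath, if_pos hk]
          linarith [hb k hk, h.le_mul i k]
        · rw [occDeath, if_neg hk, occBirth, if_neg (by omega)]
          linarith
      no_crossing := fun k hk => by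
        rw [one_div, inv_mul_eq_div, div_le_iff₀ hden, occDeath,
          if_pos (show k + 1 ≤ N from hk)]
        have h1 := h.le_mul i (k + 1)
        have h2 := hb k hk.le
        have h3 : Δ ≤ Δ * N := le_mul_of_one_le_right hΔ.le hN1
        push_cast at h1
        linarith }

/-- The logarithmic Sobolev inequality for the number of particles at one site. -/
theorem wEnt_occMean_le (h : RateBounds r δ Δ) (hS : S.Nonempty) (i : ι) {N m n : ℕ}
    (hN : 1 ≤ N) (hm : N ≤ m) (hn : S.card ≤ n) (hp : δ / (2 * Δ * m * n) ≤ 1 / 4)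
    {f : (ι → ℕ) → ℝ} (hf : ∀ x, 0 < f x) :
    wEnt (Finset.range (N + 1)) (occWeight r S i N) (occMean r S i N f)
      ≤ 10 * Real.log (1 / (δ / (2 * Δ * m * n))) / δ
        * bdEnergy N (occWeight r S i N) (occBirth r S N) (occMean r S i N f) := by
  have hδ := h.pos
  have hΔ : 0 < Δ := hδ.trans_le (h.le i)
  have hm0 : (0 : ℝ) < m := by exact_mod_cast hN.trans hm
  have hc0 : (0 : ℝ) < S.card := by exact_mod_cast hS.card_pos
  have hcn : (S.card : ℝ) ≤ n := by exact_mod_cast hn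
  have hn0 : (0 : ℝ) < n := hc0.trans_le hcn
  have hn1 : (1 : ℝ) ≤ n := by exact_mod_cast hS.card_pos.trans_le hn
  have heq : δ / (2 * Δ * m * n) = 1 / (2 * Δ * m) * (δ / n) := by field_simp
  refine (h.birthDeath hS i hN hm).wEnt_le (by positivity) hp (fun k hk => ?_) (fun k hk => ?_)
    (fun k => ?_)
  · rw [heq]
    refine mul_le_mul_of_nonneg_left ?_ (by positivity)
    exact (div_le_div_of_nonneg_left hδ.le hc0 hcn).trans (h.occBirth_bounds hS hk).1
  · rw [heq, occDeath, if_pos (show k + 1 ≤ N from hk)]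
    refine mul_le_mul_of_nonneg_left ?_ (by positivity)
    calc δ / n ≤ δ := div_le_self hδ.le hn1
      _ ≤ r i (k + 1) := by linarith [(h.incr i k).1, h.nonneg i k]
  · exact div_pos (Finset.sum_pos (fun y _ => mul_pos (h.weight_pos y) (hf _))
      (piAntidiag_nonempty hS _)) (h.partitionFn_pos hS _)

/-- The energy of the conditional means is controlled by the edges between `i` and the other sites:
conditionally on `k` or `k + 1` particles at `i`, the other sites are coupled so as to differ by one
particle. -/
theorem bdEnergy_occMean_le (h : RateBounds r δ Δ) {i : ι} (hi : i ∈ S)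
    (hS : (S.erase i).Nonempty) (N : ℕ) {f : (ι → ℕ) → ℝ} (hf : ∀ x, 0 < f x) :
    bdEnergy (N + 1) (occWeight r (S.erase i) i (N + 1)) (occBirth r (S.erase i) (N + 1))
        (occMean r (S.erase i) i (N + 1) f)
      ≤ Δ / (δ * (S.erase i).card) * ∑ z ∈ S.piAntidiag N, weight r z *
          ∑ j ∈ S.erase i, sqDist (f (z + Pi.single i 1)) (f (z + Pi.single j 1)) := by
  rw [sum_weight_mul_eq_sum_erase r hi, Finset.mul_sum]
  refine Finset.sum_le_sum fun k hk => ?_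
  have hkN : k < N + 1 := Finset.mem_range.1 hk
  have e1 : N + 1 - (k + 1) = N - k := by omega
  have e2 : N + 1 - k = N - k + 1 := by omega
  set R := S.erase i with hR
  have hZ := h.partitionFn_pos hS (N - k)
  have hZ' := h.partitionFn_pos hS (N - k + 1)
  obtain ⟨q, hq0, hq1, hq⟩ := h.exists_coupling hS (N - k)
  have hrate : occWeight r R i (N + 1) k * occBirth r R (N + 1) k
      = siteWeight (r i) k * partitionFn r R (N - k) := by
    rw [occWeight, occBirth, if_pos hkN, e1, e2]
    field_simp
  have hk0 : occMean r R i (N + 1) f k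
      = ∑ y ∈ R.piAntidiag (N - k), weight r y / partitionFn r R (N - k) *
          ∑ j ∈ R, q y j * f (y + Pi.single i k + Pi.single j 1) := by
    rw [occMean, e2]
    refine (hq fun x => f (x + Pi.single i k)).symm.trans ?_
    rw [Finset.sum_div]
    refine Finset.sum_congr rfl fun y _ => ?_
    rw [mul_div_right_comm]
    simp only [add_right_comm y]
  have hk1 : occMean r R i (N + 1) f (k + 1)
      = ∑ y ∈ R.piAntidiag (N - k), weight r y / partitionFn r R (N - k) *
          ∑ j ∈ R, q y j * f (y + Pi.single i k + Pi.single i 1) := by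
    rw [occMean, e1, Finset.sum_div]
    refine Finset.sum_congr rfl fun y hy => ?_
    rw [← Finset.sum_mul, hq1 y hy, one_mul, mul_div_right_comm, add_assoc, ← Pi.single_add]
  have hsq : sqDist (occMean r R i (N + 1) f k) (occMean r R i (N + 1) f (k + 1))
      ≤ ∑ y ∈ R.piAntidiag (N - k), weight r y / partitionFn r R (N - k) *
          ∑ j ∈ R, q y j * sqDist (f (y + Pi.single i k + Pi.single j 1))
            (f (y + Pi.single i k + Pi.single i 1)) := by
    rw [hk0, hk1]
    have hqf : ∀ y ∈ R.piAntidiag (N - k), ∀ g : ι → ℝ, (∀ j, 0 < g j) →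
        0 ≤ ∑ j ∈ R, q y j * g j := fun y hy g hg =>
      Finset.sum_nonneg fun j hj => mul_nonneg (hq0 y hy j hj).1 (hg j).le
    refine (sqDist_sum_le _ _ _ _ (fun y _ => (div_pos (h.weight_pos y) hZ).le)
      (fun y hy => hqf y hy _ fun _ => hf _) (fun y hy => hqf y hy _ fun _ => hf _)).trans
      (Finset.sum_le_sum fun y hy => ?_)
    exact mul_le_mul_of_nonneg_left (sqDist_sum_le _ _ _ _ (fun j hj => (hq0 y hy j hj).1)
      (fun _ _ => (hf _).le) (fun _ _ => (hf _).le)) (div_pos (h.weight_pos y) hZ).le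
  rw [hrate]
  refine (mul_le_mul_of_nonneg_left hsq (mul_pos (h.siteWeight_pos i k) hZ).le).trans ?_
  rw [mul_left_comm, mul_assoc]
  refine mul_le_mul_of_nonneg_left ?_ (h.siteWeight_pos i k).le
  rw [Finset.mul_sum, Finset.mul_sum]
  refine Finset.sum_le_sum fun y hy => ?_
  rw [← mul_assoc, mul_div_cancel₀ _ hZ.ne', mul_left_comm]
  refine mul_le_mul_of_nonneg_left ?_ (h.weight_pos y).le
  rw [Finset.mul_sum]
  refine Finset.sum_le_sum fun j hj => ?_
  rw [sqDist_comm]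
  exact mul_le_mul_of_nonneg_right (hq0 y hy j hj).2 (sqDist_nonneg _ _)

/-- The chain rule for the entropy, conditioning on the number of particles at `i`. -/
theorem wEnt_eq_sum_add (h : RateBounds r δ Δ) {i : ι} (hi : i ∈ S) (hS : (S.erase i).Nonempty)
    (N : ℕ) (f : (ι → ℕ) → ℝ) :
    wEnt (S.piAntidiag N) (weight r) f
      = ∑ k ∈ Finset.range (N + 1), siteWeight (r i) k *
          wEnt ((S.erase i).piAntidiag (N - k)) (weight r) (fun y => f (y + Pi.single i k))
        + wEnt (Finset.range (N + 1)) (occWeight r (S.erase i) i N)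
          (occMean r (S.erase i) i N f) := by
  have hmean : ∀ k, occWeight r (S.erase i) i N k * occMean r (S.erase i) i N f k
      = siteWeight (r i) k *
        ∑ y ∈ (S.erase i).piAntidiag (N - k), weight r y * f (y + Pi.single i k) := by
    intro k
    have := (h.partitionFn_pos hS (N - k)).ne'
    rw [occWeight, occMean]
    field_simp
  have hmass : ∑ x ∈ S.piAntidiag N, weight r x
      = ∑ k ∈ Finset.range (N + 1), occWeight r (S.erase i) i N k := by
    simpa [occWeight, partitionFn] using sum_weight_mul_eq_sum_erase r hi N fun _ => 1
  unfold wEnt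
  rw [sum_weight_mul_eq_sum_erase r hi, sum_weight_mul_eq_sum_erase r hi, hmass]
  simp only [hmean, ← mul_assoc]
  rw [add_sub_assoc', ← Finset.sum_add_distrib]
  congr 1
  refine Finset.sum_congr rfl fun k _ => ?_
  rw [mul_sub]
  simp only [occMean, partitionFn]
  ring

/-- The logarithmic Sobolev inequality for the mean-field zero-range process, by induction on the
number of sites: the chain rule is averaged over the site on which one conditions. -/
theorem wEnt_le_edgeEnergy (h : RateBounds r δ Δ) {m n : ℕ} (hm : 1 ≤ m)
    (hp : δ / (2 * Δ * m * n) ≤ 1 / 4) (s : ℕ) (hs : s + 1 ≤ n) :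
    ∀ S : Finset ι, S.card = s + 1 → ∀ N, N + 1 ≤ m → ∀ f : (ι → ℕ) → ℝ, (∀ x, 0 < f x) →
      wEnt (S.piAntidiag (N + 1)) (weight r) f
        ≤ 10 * Real.log (1 / (δ / (2 * Δ * m * n))) / δ * (Δ / δ) / (s + 1)
          * edgeEnergy r S N f := by
  set T := 10 * Real.log (1 / (δ / (2 * Δ * m * n))) / δ with hT
  have hsing : ∀ (x : ι → ℕ) (f : (ι → ℕ) → ℝ), wEnt {x} (weight r) f = 0 := by
    intro x f
    have := (h.weight_pos x).ne'
    simp only [wEnt, Finset.sum_singleton]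
    rw [mul_div_cancel_left₀ _ this]
    ring
  induction s with
  | zero =>
    intro S hS N _ f _
    obtain ⟨i, rfl⟩ := Finset.card_eq_one.1 hS
    have h1 : ({i} : Finset ι).piAntidiag (N + 1) = {Pi.single i (N + 1)} := by
      refine Finset.eq_singleton_iff_unique_mem.2 ⟨?_, fun x hx => ?_⟩
      · simpa using add_single_mem (x := 0) (N := 0) (by simp) (Finset.mem_singleton_self i) (N + 1)
      · rw [Finset.mem_piAntidiag, Finset.sum_singleton] at hx
        funext j
        by_cases hj : j = i
        · subst hj; simp [hx.1]
        · rw [Pi.single_eq_of_ne hj]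
          by_contra hne
          exact hj (Finset.mem_singleton.1 (hx.2 j hne))
    rw [h1, hsing]
    simp [edgeEnergy, sqDist_self]
  | succ s ih =>
    intro S hS N hN f hf
    have hδ := h.pos
    have hone : ∀ i ∈ S, wEnt (S.piAntidiag (N + 1)) (weight r) f
        ≤ T * (Δ / δ) / (s + 1) * ∑ z ∈ S.piAntidiag N, weight r z *
          (∑ j ∈ S, ∑ l ∈ S, sqDist (f (z + Pi.single j 1)) (f (z + Pi.single l 1))
            - ∑ j ∈ S, sqDist (f (z + Pi.single i 1)) (f (z + Pi.single j 1))) := by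
      intro i hi
      have hcard : (S.erase i).card = s + 1 := by rw [Finset.card_erase_of_mem hi, hS]; rfl
      have hne : (S.erase i).Nonempty := Finset.card_pos.1 (by omega)
      rw [h.wEnt_eq_sum_add hi hne, Finset.sum_range_succ]
      have hzero : wEnt ((S.erase i).piAntidiag (N + 1 - (N + 1))) (weight r)
          (fun y => f (y + Pi.single i (N + 1))) = 0 := by
        rw [Nat.sub_self, Finset.piAntidiag_zero, hsing]
      rw [hzero, mul_zero, add_zero]
      have hrest : ∑ k ∈ Finset.range (N + 1), siteWeight (r i) k *
            wEnt ((S.erase i).piAntidiag (N + 1 - k)) (weight r)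
              (fun y => f (y + Pi.single i k))
          ≤ T * (Δ / δ) / (s + 1) * ∑ z ∈ S.piAntidiag N, weight r z *
            ∑ j ∈ S.erase i, ∑ l ∈ S.erase i,
              sqDist (f (z + Pi.single j 1)) (f (z + Pi.single l 1)) := by
        rw [sum_weight_mul_eq_sum_erase r hi, Finset.mul_sum]
        refine Finset.sum_le_sum fun k hk => ?_
        have hkN : k < N + 1 := Finset.mem_range.1 hk
        rw [mul_left_comm]
        refine mul_le_mul_of_nonneg_left ?_ (h.siteWeight_pos i k).le
        have e1 : N + 1 - k = N - k + 1 := by omega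
        rw [e1]
        refine (ih (by omega) _ hcard (N - k) (by omega) _ fun _ => hf _).trans (le_of_eq ?_)
        simp only [edgeEnergy, add_right_comm _ _ (Pi.single i k : ι → ℕ)]
      have hocc : wEnt (Finset.range (N + 1 + 1)) (occWeight r (S.erase i) i (N + 1))
            (occMean r (S.erase i) i (N + 1) f)
          ≤ T * (Δ / δ) / (s + 1) * ∑ z ∈ S.piAntidiag N, weight r z *
            ∑ j ∈ S.erase i, sqDist (f (z + Pi.single i 1)) (f (z + Pi.single j 1)) := by
        refine (h.wEnt_occMean_le hne i (Nat.le_add_left 1 N) hN (by omega) hp hf).trans ?_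
        have hT0 : 0 ≤ T := by
          have hΔ : 0 < Δ := hδ.trans_le (h.le i)
          have hm0 : (0 : ℝ) < m := by exact_mod_cast hm
          have hn0 : (0 : ℝ) < n := by exact_mod_cast (Nat.succ_pos _).trans_le hs
          have hpos : 0 < δ / (2 * Δ * m * n) := by positivity
          have : 0 ≤ Real.log (1 / (δ / (2 * Δ * m * n))) :=
            Real.log_nonneg (by rw [le_div_iff₀ hpos]; linarith)
          positivity
        refine (mul_le_mul_of_nonneg_left (h.bdEnergy_occMean_le hi hne N hf) hT0).trans
          (le_of_eq ?_)
        rw [hcard, ← mul_assoc]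
        congr 1
        push_cast
        field_simp
      refine (add_le_add hrest hocc).trans (le_of_eq ?_)
      rw [← mul_add, ← Finset.sum_add_distrib]
      congr 1
      refine Finset.sum_congr rfl fun z _ => ?_
      rw [← mul_add, sum_erase_add_sum_erase
        (fun j l => sqDist (f (z + Pi.single j 1)) (f (z + Pi.single l 1)))
        (fun _ => sqDist_self _) (fun _ _ => sqDist_comm _ _) hi]
    have hsum := Finset.sum_le_sum hone
    rw [Finset.sum_const, hS, nsmul_eq_mul, ← Finset.mul_sum, Finset.sum_comm] at hsum
    have htot : ∑ z ∈ S.piAntidiag N, ∑ i ∈ S, weight r z *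
          (∑ j ∈ S, ∑ l ∈ S, sqDist (f (z + Pi.single j 1)) (f (z + Pi.single l 1))
            - ∑ j ∈ S, sqDist (f (z + Pi.single i 1)) (f (z + Pi.single j 1)))
        = (s + 1) * edgeEnergy r S N f := by
      rw [edgeEnergy, Finset.mul_sum]
      refine Finset.sum_congr rfl fun z _ => ?_
      rw [← Finset.mul_sum, Finset.sum_sub_distrib, Finset.sum_const, hS, nsmul_eq_mul]
      push_cast
      ring
    rw [htot] at hsum
    have hs1 : (0 : ℝ) < s + 1 := by positivity
    have h3 : T * (Δ / δ) / (s + 1) * ((s + 1) * edgeEnergy r S N f)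
        = T * (Δ / δ) * edgeEnergy r S N f := by
      field_simp
    rw [h3] at hsum
    have hs2 : (0 : ℝ) < ((s + 1 : ℕ) : ℝ) + 1 := by positivity
    rw [div_mul_eq_mul_div, le_div_iff₀ hs2, mul_comm]
    push_cast at hsum ⊢
    exact hsum

end RateBounds

end MeanField

/-! ### The Poincaré inequality for a symmetric stochastic matrix -/

/-- The Poincaré inequality for a symmetric stochastic matrix with a positive spectral gap. As
`λ₂ < 1`, the constant vector is orthogonal to all eigenvectors but the first. -/
theorem spectralGap_mul_le {n : ℕ} {G : Matrix (Fin n) (Fin n) ℝ} (hsymm : G.IsSymm)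
    (hstoch : G ∈ Matrix.rowStochastic ℝ (Fin n)) (hn : 2 ≤ n) (hgap : 0 < spectralGap G hsymm)
    (g : Fin n → ℝ) :
    spectralGap G hsymm * ∑ i, ∑ j, (g i - g j) ^ 2
      ≤ n * ∑ i, ∑ j, G i j * (g i - g j) ^ 2 := by
  have hG : G.IsHermitian := (Matrix.conjTranspose_eq_transpose_of_trivial G).trans hsymm
  set γ := spectralGap G hsymm with hγ
  let σ : Fin (Fintype.card (Fin n)) ≃ Fin n := Fintype.equivOfCardEq (Fintype.card_fin _)
  have h0 : 0 < Fintype.card (Fin n) := by rw [Fintype.card_fin]; omega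
  let k₀ : Fin n := σ ⟨0, h0⟩
  -- all eigenvalues but the first are at most `1 - γ`
  have hle : ∀ k, k ≠ k₀ → hG.eigenvalues k ≤ 1 - γ := by
    intro k hk
    have h1 : 1 - γ = hG.eigenvalues₀ ⟨1, by rw [Fintype.card_fin]; exact hn⟩ := by
      rw [hγ, spectralGap, dif_pos hn]; ring
    rw [h1]
    refine hG.eigenvalues₀_antitone ?_
    have h2 : σ.symm k ≠ ⟨0, h0⟩ := fun h => hk (σ.symm_apply_eq.1 h)
    rw [Fin.le_def]
    have h3 : (σ.symm k : ℕ) ≠ 0 := fun h => h2 (Fin.ext h)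
    exact Nat.one_le_iff_ne_zero.2 h3
  let v : Fin n → Fin n → ℝ := fun k => hG.eigenvectorBasis k
  let c : (Fin n → ℝ) → Fin n → ℝ := fun u k => ∑ i, v k i * u i
  have hparseval : ∀ u w : Fin n → ℝ, ∑ k, c u k * c w k = ∑ i, u i * w i := by
    intro u w
    have := hG.eigenvectorBasis.sum_inner_mul_inner (WithLp.toLp 2 u) (WithLp.toLp 2 w)
    simp only [PiLp.inner_apply, RCLike.inner_apply, conj_trivial] at this
    simp only [c, v]
    calc _ = _ := Finset.sum_congr rfl fun k _ => by
            congr 1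
            exact Finset.sum_congr rfl fun i _ => mul_comm _ _
      _ = _ := this
      _ = _ := Finset.sum_congr rfl fun i _ => mul_comm _ _
  have hcoef : ∀ (u : Fin n → ℝ) k, c (fun i => ∑ j, G i j * u j) k = hG.eigenvalues k * c u k := by
    intro u k
    have h1 : ∀ j, ∑ i, G j i * v k i = hG.eigenvalues k * v k j := fun j =>
      congrFun (hG.mulVec_eigenvectorBasis k) j
    simp only [c, Finset.mul_sum]
    rw [Finset.sum_comm]
    refine Finset.sum_congr rfl fun j _ => ?_
    rw [← mul_assoc, ← h1 j, Finset.sum_mul]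
    refine Finset.sum_congr rfl fun i _ => ?_
    rw [← hsymm.apply i j]; ring
  have hrow : ∀ i, ∑ j, G i j = 1 := Matrix.sum_row_of_mem_rowStochastic hstoch
  have hcol : ∀ j, ∑ i, G i j = 1 := fun j => by
    rw [← hrow j]
    exact Finset.sum_congr rfl fun i _ => hsymm.apply _ _
  -- the constant vector is a multiple of the first eigenvector
  have hone : ∀ k, (1 - hG.eigenvalues k) * c (fun _ => 1) k = 0 := by
    intro k
    have h1 := hcoef (fun _ => 1) k
    simp only [mul_one, hrow] at h1
    linarith
  have hone' : ∀ k, k ≠ k₀ → c (fun _ => 1) k = 0 := by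
    intro k hk
    refine (mul_eq_zero.1 (hone k)).resolve_left ?_
    have := hle k hk
    linarith
  have hn0 : (0 : ℝ) < n := by exact_mod_cast (by omega : 0 < n)
  have hc1 : c (fun _ => 1) k₀ ^ 2 = n := by
    have h1 := hparseval (fun _ => 1) fun _ => 1
    rw [Finset.sum_eq_single k₀ (fun k _ hk => by rw [hone' k hk, zero_mul]) (by simp)] at h1
    simp at h1
    rw [sq, h1]
  have hlam : hG.eigenvalues k₀ = 1 := by
    have h1 : c (fun _ => 1) k₀ ≠ 0 := fun h => by
      rw [h] at hc1
      norm_num at hc1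
      linarith
    have := (mul_eq_zero.1 (hone k₀)).resolve_right h1
    linarith
  have hck₀ : n * c g k₀ ^ 2 = (∑ i, g i) ^ 2 := by
    have h1 := hparseval (fun _ => 1) g
    rw [Finset.sum_eq_single k₀ (fun k _ hk => by rw [hone' k hk, zero_mul]) (by simp)] at h1
    simp only [one_mul] at h1
    rw [← h1, mul_pow, hc1]
  have hvar : ∑ i, ∑ j, (g i - g j) ^ 2 = 2 * (n * ∑ i, g i * g i - (∑ i, g i) ^ 2) := by
    have h1 : ∀ i, ∑ j, (g i - g j) ^ 2
        = n * (g i * g i) - 2 * g i * ∑ j, g j + ∑ j, g j * g j := by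
      intro i
      simp only [sub_sq, Finset.sum_add_distrib, Finset.sum_sub_distrib, Finset.sum_const,
        Finset.card_univ, Fintype.card_fin, nsmul_eq_mul, ← Finset.mul_sum]
      simp only [sq]
    simp only [h1, Finset.sum_add_distrib, Finset.sum_sub_distrib, ← Finset.mul_sum,
      ← Finset.sum_mul, Finset.sum_const, Finset.card_univ, Fintype.card_fin, nsmul_eq_mul]
    ring
  have hdir : ∑ i, ∑ j, G i j * (g i - g j) ^ 2
      = 2 * (∑ i, g i * g i - ∑ i, g i * ∑ j, G i j * g j) := by
    have h1 : ∑ i, ∑ j, G i j * (g i - g j) ^ 2 = ∑ i, (∑ j, G i j) * (g i * g i)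
        - 2 * ∑ i, g i * ∑ j, G i j * g j + ∑ j, (∑ i, G i j) * (g j * g j) := by
      simp only [Finset.sum_mul, Finset.mul_sum]
      rw [Finset.sum_comm (f := fun j i => G i j * (g j * g j)), ← Finset.sum_sub_distrib,
        ← Finset.sum_add_distrib]
      refine Finset.sum_congr rfl fun i _ => ?_
      rw [← Finset.sum_sub_distrib, ← Finset.sum_add_distrib]
      exact Finset.sum_congr rfl fun j _ => by ring
    rw [h1]
    simp only [hrow, hcol, one_mul]
    ring
  have hkey : γ * (∑ k, c g k * c g k - c g k₀ ^ 2)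
      ≤ ∑ k, c g k * c g k - ∑ k, c g k * (hG.eigenvalues k * c g k) := by
    rw [← Finset.add_sum_erase _ _ (Finset.mem_univ k₀),
      ← Finset.add_sum_erase _ _ (Finset.mem_univ k₀), hlam]
    have h1 : γ * ∑ k ∈ Finset.univ.erase k₀, c g k * c g k
        ≤ ∑ k ∈ Finset.univ.erase k₀, c g k * c g k
          - ∑ k ∈ Finset.univ.erase k₀, c g k * (hG.eigenvalues k * c g k) := by
      rw [Finset.mul_sum, ← Finset.sum_sub_distrib]
      refine Finset.sum_le_sum fun k hk => ?_
      have h2 := hle k (Finset.ne_of_mem_erase hk)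
      nlinarith [mul_self_nonneg (c g k)]
    linarith
  have h2 := hparseval g fun i => ∑ j, G i j * g j
  simp only [hcoef] at h2
  rw [hparseval g g, h2] at hkey
  rw [hvar, hdir, ← hck₀]
  have h3 := mul_le_mul_of_nonneg_left hkey hn0.le
  linarith

/-! ### Zero-range processes on arbitrary geometries -/

namespace MeanField

open ZRP

variable {n : ℕ}

theorem sum_state_eq (m : ℕ) (Φ : (Fin n → ℕ) → ℝ) :
    ∑ x : State n m, Φ x.1 = ∑ x ∈ Finset.univ.piAntidiag m, Φ x :=
  (Finset.sum_subtype (Finset.univ.piAntidiag m) (by simp) Φ).symm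

/-- The extension, by `1`, of a function on `m`-particle configurations to all configurations. -/
def extendOne {m : ℕ} (f : State n m → ℝ) (x : Fin n → ℕ) : ℝ :=
  if h : ∑ i, x i = m then f ⟨x, h⟩ else 1

theorem extendOne_coe {m : ℕ} (f : State n m → ℝ) (x : State n m) : extendOne f x.1 = f x :=
  dif_pos x.2

/-- The configuration obtained by adding a particle at `i`. -/
def addParticle {N : ℕ} (w : State n N) (i : Fin n) : State n (N + 1) :=
  ⟨w.1 + Pi.single i 1, by
    have := w.2
    simp [Finset.sum_add_distrib, this]⟩

theorem move_addParticle {N : ℕ} (w : State n N) (i j : Fin n) :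
    move (addParticle w i) i j = addParticle w j := by
  have h : (addParticle w i).1 i ≠ 0 := by simp [addParticle]
  rw [move, dif_neg h]
  refine Subtype.ext ?_
  simp only [addParticle]
  rw [add_right_comm, add_tsub_cancel_right]

variable {r : Fin n → ℕ → ℝ} {δ Δ : ℝ} {G : Matrix (Fin n) (Fin n) ℝ} {N : ℕ}

theorem RateBounds.sum_state_mul_rate (h : RateBounds r δ Δ) (i : Fin n)
    (Ψ : State n (N + 1) → ℝ) :
    ∑ x : State n (N + 1), weight r x.1 * r i (x.1 i) * Ψ x
      = ∑ w : State n N, weight r w.1 * Ψ (addParticle w i) := by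
  have h1 := h.sum_weight_mul_rate (Finset.mem_univ i) N (extendOne Ψ)
  rw [← sum_state_eq, ← sum_state_eq] at h1
  have h2 : ∀ w : State n N, extendOne Ψ (w.1 + Pi.single i 1) = Ψ (addParticle w i) :=
    fun w => extendOne_coe Ψ (addParticle w i)
  simpa only [extendOne_coe, h2] using h1

/-- Sums over the jumps of the zero-range process are sums over the configurations of the other
particles. -/
theorem RateBounds.sum_state_jumps (h : RateBounds r δ Δ)
    (K : State n (N + 1) → State n (N + 1) → ℝ) :
    ∑ x : State n (N + 1), weight r x.1 * ∑ i, ∑ j, r i (x.1 i) * G i j * K x (move x i j)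
      = ∑ w : State n N, weight r w.1 *
          ∑ i, ∑ j, G i j * K (addParticle w i) (addParticle w j) := by
  simp only [Finset.mul_sum]
  rw [Finset.sum_comm]
  conv_rhs => rw [Finset.sum_comm]
  refine Finset.sum_congr rfl fun i _ => ?_
  rw [Finset.sum_comm]
  conv_rhs => rw [Finset.sum_comm]
  refine Finset.sum_congr rfl fun j _ => ?_
  have := h.sum_state_mul_rate i fun x => G i j * K x (move x i j)
  simp only [move_addParticle] at this
  rw [← this]
  exact Finset.sum_congr rfl fun x _ => by ring

theorem sum_rateMatrix_mul (m : ℕ) (r : Fin n → ℕ → ℝ) (G : Matrix (Fin n) (Fin n) ℝ)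
    (φ : State n m → ℝ) (x : State n m) :
    ∑ y, rateMatrix m r G x y * φ y = gen m r G φ x := by
  simp only [rateMatrix, gen, Finset.sum_mul]
  rw [Finset.sum_comm]
  refine Finset.sum_congr rfl fun i _ => ?_
  rw [Finset.sum_comm]
  refine Finset.sum_congr rfl fun j _ => ?_
  simp only [mul_assoc]
  rw [← Finset.mul_sum, ← Finset.mul_sum]
  simp [Pi.single_apply, sub_mul, Finset.sum_sub_distrib]

theorem sum_mul_gen_eq_zero {m : ℕ} {π : State n m → ℝ}
    (hπ : MarkovGen.IsReversible (rateMatrix m r G) π) (φ : State n m → ℝ) :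
    ∑ x, π x * gen m r G φ x = 0 := by
  simp only [← sum_rateMatrix_mul, Finset.mul_sum]
  rw [Finset.sum_comm]
  refine Finset.sum_eq_zero fun y _ => ?_
  have h1 : ∀ x, π x * (rateMatrix m r G x y * φ y)
      = π y * φ y * (rateMatrix m r G y x * (1 : ℝ)) := fun x => by
    linear_combination φ y * hπ.balance x y
  simp only [h1]
  rw [← Finset.mul_sum, sum_rateMatrix_mul m r G fun _ => 1]
  simp [gen]

/-- If `G` has a positive spectral gap, the reversible measure is the normalised product weight:
testing stationarity against its density shows that the density is constant. -/
theorem RateBounds.reversible_eq (h : RateBounds r δ Δ) (hn : 2 ≤ n) (hsymm : G.IsSymm)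
    (hstoch : G ∈ Matrix.rowStochastic ℝ (Fin n)) (hgap : 0 < spectralGap G hsymm)
    {π : State n (N + 1) → ℝ} (hπ : MarkovGen.IsReversible (rateMatrix (N + 1) r G) π)
    (x : State n (N + 1)) :
    π x = weight r x.1 / partitionFn r Finset.univ (N + 1) := by
  set u : State n (N + 1) → ℝ := fun x => π x / weight r x.1 with hu
  have hπu : ∀ x, π x = weight r x.1 * u x := fun x => by
    have := (h.weight_pos x.1).ne'
    rw [hu]; field_simp
  have h0 : ∑ w : State n N, weight r w.1 *
      ∑ i, ∑ j, G i j * (u (addParticle w i) - u (addParticle w j)) ^ 2 = 0 := by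
    have h1 := sum_mul_gen_eq_zero hπ u
    have h2 := h.sum_state_jumps (N := N) (G := G) fun x y => u x * (u y - u x)
    have h3 : ∑ x : State n (N + 1), weight r x.1 *
        ∑ i, ∑ j, r i (x.1 i) * G i j * (u x * (u (move x i j) - u x)) = 0 := by
      rw [← h1]
      refine Finset.sum_congr rfl fun x _ => ?_
      rw [hπu x, mul_assoc]
      congr 1
      rw [gen, Finset.mul_sum]
      refine Finset.sum_congr rfl fun i _ => ?_
      rw [Finset.mul_sum]
      exact Finset.sum_congr rfl fun j _ => by ring
    rw [h2] at h3
    rw [← mul_zero (-2 : ℝ), ← h3, Finset.mul_sum]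
    refine Finset.sum_congr rfl fun w _ => ?_
    rw [mul_left_comm]
    congr 1
    set v : Fin n → ℝ := fun i => u (addParticle w i)
    have hswap : ∑ i, ∑ j, G i j * (v i * (v j - v i)) = ∑ i, ∑ j, G i j * (v j * (v i - v j)) := by
      rw [Finset.sum_comm]
      refine Finset.sum_congr rfl fun i _ => Finset.sum_congr rfl fun j _ => ?_
      rw [hsymm.apply i j]
    change ∑ i, ∑ j, G i j * (v i - v j) ^ 2 = -2 * ∑ i, ∑ j, G i j * (v i * (v j - v i))
    have h4 : ∑ i, ∑ j, G i j * (v i - v j) ^ 2 = -∑ i, ∑ j, G i j * (v i * (v j - v i))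
        - ∑ i, ∑ j, G i j * (v j * (v i - v j)) := by
      simp only [← Finset.sum_neg_distrib, ← Finset.sum_sub_distrib]
      exact Finset.sum_congr rfl fun i _ => Finset.sum_congr rfl fun j _ => by ring
    rw [h4, ← hswap]; ring
  have hGnn : ∀ i j, 0 ≤ G i j := fun i j => Matrix.nonneg_of_mem_rowStochastic hstoch
  have hedge : ∀ (w : State n N) i j, u (addParticle w i) = u (addParticle w j) := by
    intro w i j
    have h1 := (Finset.sum_eq_zero_iff_of_nonneg fun w _ => mul_nonneg (h.weight_pos _).le
      (Finset.sum_nonneg fun i _ => Finset.sum_nonneg fun j _ =>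
        mul_nonneg (hGnn i j) (sq_nonneg _))).1 h0 w (Finset.mem_univ w)
    have h2 := (mul_eq_zero.1 h1).resolve_left (h.weight_pos w.1).ne'
    have h3 := spectralGap_mul_le hsymm hstoch hn hgap fun i => u (addParticle w i)
    rw [h2, mul_zero] at h3
    have h4 : ∑ i, ∑ j, (u (addParticle w i) - u (addParticle w j)) ^ 2 = 0 :=
      le_antisymm (by nlinarith)
        (Finset.sum_nonneg fun i _ => Finset.sum_nonneg fun j _ => sq_nonneg _)
    have h5 := (Finset.sum_eq_zero_iff_of_nonneg fun i _ =>
      Finset.sum_nonneg fun j _ => sq_nonneg _).1 h4 i (Finset.mem_univ i)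
    have h6 := (Finset.sum_eq_zero_iff_of_nonneg fun j _ => sq_nonneg _).1 h5 j (Finset.mem_univ j)
    exact sub_eq_zero.1 (pow_eq_zero_iff two_ne_zero |>.1 h6)
  have hmem : ∀ x : State n (N + 1), x.1 ∈ Finset.univ.piAntidiag (N + 1) := fun x => by
    simpa using x.2
  have hconst : ∀ y, u y = u x := by
    intro y
    have h1 := eq_of_forall_move_eq (S := Finset.univ) (N := N) (u := extendOne u)
      (fun w hw i _ j _ => by
        have hw' : ∑ i, w i = N := by simpa using hw
        have h2 := hedge ⟨w, hw'⟩ i j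
        rwa [← extendOne_coe u, ← extendOne_coe u] at h2) y.1 (hmem y) x.1 (hmem x)
    rwa [extendOne_coe, extendOne_coe] at h1
  have hZ : 0 < partitionFn r Finset.univ (N + 1) :=
    h.partitionFn_pos ⟨⟨0, by omega⟩, Finset.mem_univ _⟩ _
  have h6 : partitionFn r Finset.univ (N + 1) * u x = 1 := by
    rw [← hπ.sum_eq_one, partitionFn, ← sum_state_eq, Finset.sum_mul]
    exact Finset.sum_congr rfl fun y _ => by rw [hπu y, hconst y]
  rw [hπu x, eq_div_iff hZ.ne', mul_assoc, mul_comm (u x), h6, mul_one]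

variable {Z : ℝ} {π : State n (N + 1) → ℝ}

theorem RateBounds.dirichlet_sqrt_eq (h : RateBounds r δ Δ)
    (hπ : ∀ x, π x = weight r x.1 / Z) (f : State n (N + 1) → ℝ) :
    MarkovGen.dirichlet (rateMatrix (N + 1) r G) π (fun x => Real.sqrt (f x))
        (fun x => Real.sqrt (f x))
      = 1 / (2 * Z) * ∑ w : State n N, weight r w.1 *
          ∑ i, ∑ j, G i j * sqDist (f (addParticle w i)) (f (addParticle w j)) := by
  have hinner : ∀ x, ∑ y, π x * rateMatrix (N + 1) r G x y * (Real.sqrt (f x) - Real.sqrt (f y))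
        * (Real.sqrt (f x) - Real.sqrt (f y))
      = 1 / Z * (weight r x.1 *
        ∑ i, ∑ j, r i (x.1 i) * G i j * sqDist (f x) (f (move x i j))) := by
    intro x
    have h1 := sum_rateMatrix_mul (N + 1) r G (fun y => sqDist (f x) (f y)) x
    simp only [gen, sqDist_self, sub_zero] at h1
    rw [← h1, hπ, Finset.mul_sum, Finset.mul_sum]
    exact Finset.sum_congr rfl fun y _ => by unfold sqDist; ring
  rw [MarkovGen.dirichlet, Finset.sum_congr rfl fun x _ => hinner x, ← Finset.mul_sum,
    h.sum_state_jumps fun x y => sqDist (f x) (f y)]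
  ring

theorem ent_eq_wEnt_div (hZ : partitionFn r Finset.univ (N + 1) = Z)
    (hπ : ∀ x, π x = weight r x.1 / Z) (f : State n (N + 1) → ℝ) :
    MarkovGen.ent π f
      = wEnt (Finset.univ.piAntidiag (N + 1)) (weight r) (extendOne f) / Z := by
  have h1 : ∀ g : State n (N + 1) → ℝ,
      MarkovGen.expect π g = (∑ x : State n (N + 1), weight r x.1 * g x) / Z := by
    intro g
    rw [MarkovGen.expect, Finset.sum_div]
    exact Finset.sum_congr rfl fun x _ => by rw [hπ]; ring
  unfold MarkovGen.ent wEnt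
  rw [h1, h1, ← sum_state_eq, ← sum_state_eq, ← partitionFn, hZ]
  simp only [extendOne_coe]
  ring

theorem edgeEnergy_extendOne (f : State n (N + 1) → ℝ) :
    edgeEnergy r Finset.univ N (extendOne f) = ∑ w : State n N, weight r w.1 *
      ∑ i, ∑ j, sqDist (f (addParticle w i)) (f (addParticle w j)) := by
  rw [edgeEnergy, ← sum_state_eq]
  simp only [← extendOne_coe f (addParticle _ _)]
  rfl

/-- Comparison of the geometry `G` with the complete graph. -/
theorem RateBounds.lsi (h : RateBounds r δ Δ) (hn : 2 ≤ n) (hsymm : G.IsSymm)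
    (hstoch : G ∈ Matrix.rowStochastic ℝ (Fin n)) (hgap : 0 < spectralGap G hsymm)
    (hπ : MarkovGen.IsReversible (rateMatrix (N + 1) r G) π) :
    MarkovGen.LSI (rateMatrix (N + 1) r G) π
      (40 * Δ / δ ^ 2 * Real.log (Δ * (N + 1 : ℕ) * n / δ) / spectralGap G hsymm) := by
  have hδ := h.pos
  have hδΔ : δ ≤ Δ := h.le ⟨0, by omega⟩
  have hΔ : 0 < Δ := hδ.trans_le hδΔ
  have hm1 : (1 : ℝ) ≤ (N + 1 : ℕ) := by exact_mod_cast Nat.le_add_left 1 N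
  have hn2 : (2 : ℝ) ≤ n := by exact_mod_cast hn
  set m : ℝ := ((N + 1 : ℕ) : ℝ) with hm
  have hm0 : 0 < m := by linarith
  have hn0 : (0 : ℝ) < n := by linarith
  have hρ : 2 ≤ Δ * m * n / δ := by
    rw [le_div_iff₀ hδ]
    have h1 : δ ≤ Δ * m := hδΔ.trans (le_mul_of_one_le_right hΔ.le hm1)
    calc 2 * δ ≤ n * (Δ * m) := mul_le_mul hn2 h1 hδ.le hn0.le
      _ = _ := by ring
  set ρ := Δ * m * n / δ with hρdef
  have hinv : 1 / (δ / (2 * Δ * m * n)) = 2 * ρ := by rw [hρdef]; field_simp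
  have hp4 : δ / (2 * Δ * m * n) ≤ 1 / 4 := by
    rw [← one_div_one_div (δ / (2 * Δ * m * n)), hinv]
    exact one_div_le_one_div_of_le (by norm_num) (by linarith)
  have hlog : Real.log (1 / (δ / (2 * Δ * m * n))) ≤ 2 * Real.log ρ := by
    rw [hinv, Real.log_mul (by norm_num) (by linarith)]
    linarith [Real.log_le_log (by norm_num) hρ]
  have hrev := h.reversible_eq hn hsymm hstoch hgap hπ
  have hZ : 0 < partitionFn r Finset.univ (N + 1) :=
    h.partitionFn_pos ⟨⟨0, by omega⟩, Finset.mem_univ _⟩ _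
  set Z := partitionFn r Finset.univ (N + 1) with hZdef
  intro f hf
  have hFpos : ∀ x, 0 < extendOne f x := by
    intro x
    unfold extendOne
    split_ifs
    · exact hf _
    · exact one_pos
  obtain ⟨s, rfl⟩ : ∃ s, n = s + 1 := ⟨n - 1, by omega⟩
  have hmf := h.wEnt_le_edgeEnergy (m := N + 1) (n := s + 1) (Nat.le_add_left 1 N) hp4 s le_rfl
    Finset.univ (by simp) N le_rfl (extendOne f) hFpos
  rw [edgeEnergy_extendOne] at hmf
  rw [ent_eq_wEnt_div hZdef.symm hrev, h.dirichlet_sqrt_eq hrev]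
  set γ := spectralGap G hsymm
  set E := ∑ w : State (s + 1) N, weight r w.1 *
    ∑ i, ∑ j, sqDist (f (addParticle w i)) (f (addParticle w j))
  set E' := ∑ w : State (s + 1) N, weight r w.1 *
    ∑ i, ∑ j, G i j * sqDist (f (addParticle w i)) (f (addParticle w j)) with hE'
  have hcomp : γ * E ≤ (s + 1 : ℕ) * E' := by
    rw [Finset.mul_sum, hE', Finset.mul_sum]
    refine Finset.sum_le_sum fun w _ => ?_
    rw [mul_left_comm, mul_left_comm _ (weight r w.1)]
    exact mul_le_mul_of_nonneg_left
      (spectralGap_mul_le hsymm hstoch hn hgap fun i => Real.sqrt (f (addParticle w i)))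
      (h.weight_pos w.1).le
  have hE0 : 0 ≤ E := Finset.sum_nonneg fun w _ => mul_nonneg (h.weight_pos _).le
    (Finset.sum_nonneg fun i _ => Finset.sum_nonneg fun j _ => sqDist_nonneg _ _)
  have hlogρ : 0 ≤ Real.log ρ := Real.log_nonneg (by linarith)
  have hE : E ≤ (s + 1 : ℕ) * E' / γ := by
    rw [le_div_iff₀ hgap]
    linarith
  -- `40 = 10 * 2 * 2`: the constant for birth–death chains, then `log (2ρ) ≤ 2 log ρ`, then the
  -- factor `1 / 2` in the Dirichlet form
  calc wEnt (Finset.univ.piAntidiag (N + 1)) (weight r) (extendOne f) / Z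
      ≤ (10 * (2 * Real.log ρ) / δ * (Δ / δ) / (s + 1) * E) / Z := by
        refine div_le_div_of_nonneg_right (hmf.trans ?_) hZ.le
        gcongr
    _ ≤ (10 * (2 * Real.log ρ) / δ * (Δ / δ) / (s + 1) * ((s + 1 : ℕ) * E' / γ)) / Z := by
        gcongr
    _ = 40 * Δ / δ ^ 2 * Real.log ρ / γ * (1 / (2 * Z) * E') := by
        push_cast
        field_simp
        ring

theorem lsi_of_subsingleton {X : Type*} [Fintype X] [Subsingleton X] {Q : Matrix X X ℝ} {π : X → ℝ}
    (hπ : MarkovGen.IsReversible Q π) : MarkovGen.LSI Q π 0 := by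
  intro f _
  obtain ⟨x⟩ : Nonempty X := by
    by_contra hne
    rw [not_nonempty_iff] at hne
    simpa using hπ.sum_eq_one
  have h1 : ∀ g : X → ℝ, MarkovGen.expect π g = g x := by
    intro g
    calc ∑ y, π y * g y = ∑ y, π y * g x :=
          Finset.sum_congr rfl fun y _ => by rw [Subsingleton.elim y x]
      _ = g x := by rw [← Finset.sum_mul, hπ.sum_eq_one, one_mul]
  rw [MarkovGen.ent, h1, h1]
  simp

end MeanField

theorem corollary5 (n m : ℕ) (hn : 1 ≤ n) (hm : 1 ≤ m)
    (G : Matrix (Fin n) (Fin n) ℝ) (hsymm : G.IsSymm) (hstoch : G ∈ Matrix.rowStochastic ℝ (Fin n))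
    (r : Fin n → ℕ → ℝ) (hr0 : ∀ i, r i 0 = 0)
    (δ Δ : ℝ) (hδ : 0 < δ) (hΔ : 0 < Δ)
    (hr : ∀ i k, δ ≤ r i (k + 1) - r i k ∧ r i (k + 1) - r i k ≤ Δ)
    (π : ZRP.State n m → ℝ) (hπ : MarkovGen.IsReversible (ZRP.rateMatrix m r G) π) :
    MarkovGen.tLS (ZRP.rateMatrix m r G) π
      ≤ ENNReal.ofReal (40 * Δ / δ ^ 2 * Real.log (Δ * m * n / δ))
          / ENNReal.ofReal (spectralGap G hsymm) := by
  have h : MeanField.RateBounds r δ Δ := ⟨hδ, hr0, hr⟩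
  rcases hn.lt_or_eq with hn2 | rfl
  · obtain ⟨N, rfl⟩ : ∃ N, m = N + 1 := ⟨m - 1, by omega⟩
    have hρ : 1 < Δ * (N + 1 : ℕ) * n / δ := by
      rw [one_lt_div hδ]
      have h1 : (1 : ℝ) ≤ (N + 1 : ℕ) := by exact_mod_cast hm
      have h2 : (1 : ℝ) < n := by exact_mod_cast hn2
      have h3 : δ ≤ Δ := h.le ⟨0, hn⟩
      nlinarith [mul_le_mul_of_nonneg_left h1 hΔ.le]
    have hpos : 0 < 40 * Δ / δ ^ 2 * Real.log (Δ * (N + 1 : ℕ) * n / δ) :=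
      mul_pos (by positivity) (Real.log_pos hρ)
    rcases le_or_gt (spectralGap G hsymm) 0 with hgap | hgap
    · -- without a spectral gap the right-hand side is infinite
      rw [ENNReal.ofReal_of_nonpos hgap, ENNReal.div_zero (ENNReal.ofReal_pos.2 hpos).ne']
      exact le_top
    · rw [← ENNReal.ofReal_div_of_pos hgap, MarkovGen.tLS]
      refine sInf_le ?_
      exact ⟨_, (div_pos hpos hgap).le, h.lsi hn2 hsymm hstoch hgap hπ, rfl⟩
  · have : Subsingleton (ZRP.State 1 m) := ⟨fun x y => Subtype.ext (funext fun i => by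
      have hx := x.2
      have hy := y.2
      rw [Fin.sum_univ_one] at hx hy
      rw [Subsingleton.elim i 0, hx, hy])⟩
    rw [MarkovGen.tLS]
    have h0 : (0 : ENNReal) ∈ {c : ENNReal | ∃ t : ℝ, 0 ≤ t ∧
        MarkovGen.LSI (ZRP.rateMatrix m r G) π t ∧ c = ENNReal.ofReal t} :=
      ⟨0, le_rfl, MeanField.lsi_of_subsingleton hπ, by simp⟩
    exact (sInf_le h0).trans zero_le
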